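/- A computable linear order is a linear order whose domain is a computable subset of $\omega$ and whose order relation is computable; it is ill-founded if it is not a well-order. A descending sequence through $\mathcal L$ is a function $f:\omega\to\omega$ with values in the domain of $\mathcal L$ such that $f(k+1)<_{\mathcal L} f(k)$ for all $k$. Let $n\in\omega$. (1) If $\mathcal L_0,\dots,\mathcal L_{n-1}$ are computable ill-founded linear orders and $X\subseteq\omega$ is not $\Delta^0_{n+1}$, then there are descending sequences $f_0,\dots,f_{n-1}$ through $\mathcal L_0,\dots,\mathcal L_{n-1}$, respectively, such that $X\not\le_T f_0\oplus\dots\oplus f_{n-1}$. (2) This bound is optimal: there are computable ill-founded linear orders $\mathcal L_0,\dots,\mathcal L_{n-1}$ such that, whenever $f_0,\dots,f_{n-1}$ are descending sequences through $\mathcal L_0,\dots,\mathcal L_{n-1}$, respectively, every $\Delta^0_{n+1}$ set $X\subseteq\omega$ satisfies $X\le_T f_0\oplus\dots\oplus f_{n-1}$ (equivalently, $\emptyset^{(n)}\le_T f_0\oplus\dots\oplus f_{n-1}$). -/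

import Mathlib

/-- A computable (strict) linear order: its domain is a computable set of natural numbers, and its
order relation is a computable relation on that domain. -/
structure ComputableLinearOrder where
  carrier : Set ℕ
  lt : ℕ → ℕ → Prop
  carrier_computable : ComputablePred fun a : ℕ => a ∈ carrier
  lt_computable :
    ComputablePred fun p : ℕ × ℕ => p.1 ∈ carrier ∧ p.2 ∈ carrier ∧ lt p.1 p.2
  lt_irrefl : ∀ a ∈ carrier, ¬ lt a a
  lt_trans : ∀ a ∈ carrier, ∀ b ∈ carrier, ∀ c ∈ carrier, lt a b → lt b c → lt a c
  lt_total : ∀ a ∈ carrier, ∀ b ∈ carrier, a ≠ b → lt a b ∨ lt b a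

namespace ComputableLinearOrder

/-- The order is ill-founded: its strict relation, on its domain, is not well-founded. -/
def IllFounded (L : ComputableLinearOrder) : Prop :=
  ¬ WellFounded fun a b : L.carrier => L.lt a b

/-- `f` is an infinite descending sequence through `L`. -/
def IsDescending (L : ComputableLinearOrder) (f : ℕ → ℕ) : Prop :=
  ∀ k, f k ∈ L.carrier ∧ L.lt (f (k + 1)) (f k)

end ComputableLinearOrder

/-- The class `Σ⁰ₙ` of the arithmetical hierarchy: `Σ⁰₀` consists of the computable sets, and `A` is
`Σ⁰ₙ₊₁` if `x ∈ A ↔ ∃ y, ⟨x, y⟩ ∉ B` for some `Σ⁰ₙ` set `B` (so the matrix is `Π⁰ₙ`). -/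
def IsSigmaZero : ℕ → Set ℕ → Prop
  | 0, A => ComputablePred fun x : ℕ => x ∈ A
  | n + 1, A => ∃ B : Set ℕ, IsSigmaZero n B ∧ ∀ x, x ∈ A ↔ ∃ y, Nat.pair x y ∉ B

/-- `Π⁰ₙ`: the complements of `Σ⁰ₙ` sets. -/
def IsPiZero (n : ℕ) (A : Set ℕ) : Prop := IsSigmaZero n Aᶜ

/-- `Δ⁰ₙ`: both `Σ⁰ₙ` and `Π⁰ₙ`. -/
def IsDeltaZero (n : ℕ) (A : Set ℕ) : Prop := IsSigmaZero n A ∧ IsPiZero n A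

/-- The join `f₀ ⊕ ⋯ ⊕ fₙ₋₁`, with value `fᵢ k` at `⟨i, k⟩` for `i < n`, and `0` elsewhere. -/
def seqJoin {n : ℕ} (f : Fin n → ℕ → ℕ) (m : ℕ) : ℕ :=
  if h : m.unpair.1 < n then f ⟨m.unpair.1, h⟩ m.unpair.2 else 0

open Classical in
/-- The characteristic function of a set of natural numbers. -/
noncomputable def charFun (X : Set ℕ) (m : ℕ) : ℕ := if m ∈ X then 1 else 0

/-- `X ≤_T g`: the set `X` is Turing reducible to the function `g`. -/
def SetTuringReducible (X : Set ℕ) (g : ℕ → ℕ) : Prop :=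
  TuringReducible (fun m => Part.some (charFun X m)) (fun m => Part.some (g m))

-- Cone avoidance. Let `S` be a largest set of indices such that every `L i` with `i ∈ S` has a
-- descending sequence whose graph is Σ⁰ at level `S.card + 1`, and fix such sequences. If `S`
-- contains all indices, their join has a Σ⁰ₙ₊₁ graph and computes only Δ⁰ₙ₊₁ sets. Otherwise
-- maximality says that, for each k ≥ 1, fewer than k of the remaining orders have descending
-- sequences of level `S.card + k + 1`. The remaining sequences are built by forcing with finite
-- descending tuples whose last entries lie in the ill-founded parts of the orders ("good" tuples);
-- `exists_goodDesc_diagonal` meets one requirement.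
--
-- Suppose that a functional cannot be diagonalized beyond some good tuple. Then good tuples compute
-- only initial segments of X. Goodness need not be arithmetical, but it passes upward in the last
-- entries, so a good tuple is stable: no finite tuple with last entries at least as large computes
-- an incompatible string. Stability is Σ⁰ at level `S.card + 2`. If stable strings never split
-- beyond some bound, X would be Δ⁰ at that level. So there is a sequence of pairs ("blocks") of
-- stable tuples that split at ever higher levels. `exists_blockAscending` thins such a sequence, at
-- the cost of one jump, so that the last entries in one order do not descend from block to block,
-- provided that this order has no descending sequence of the current complexity. The count above
-- lets every remaining order be treated in turn. Now stability of the first block makes both of its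
-- strings agree with those of every later block, yet a later block that splits beyond the first
-- splitting position cannot agree with both: a contradiction.
--
-- Optimality. Column j of `leastWit` records least witnesses for a complete Σ⁰ⱼ₊₁ set. The columns
-- up to k are the only path of a computable tree, and the k-th order is the Kleene–Brouwer order on
-- it. A descending sequence converges to the path and no term lies to its left. Given the earlier
-- columns, nonzero entries of column k can be verified, while a wrong zero would put the string to
-- the left of the path. So each order yields one more jump (`ce_leastWit`).

attribute [fun_prop] Primrec PrimrecPred
attribute [fun_prop] Primrec.id Primrec.const Primrec.fst Primrec.snd Primrec.succ Primrec.unpair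
  Primrec.list_length Primrec.encode Primrec.list_range

/-! ### Closure properties of primitive recursive functions and predicates -/

section PrimrecClosure

variable {α β γ : Type*} [Primcodable α] [Primcodable β] [Primcodable γ]

@[fun_prop] theorem Primrec.comp' {f : β → γ} {g : α → β} (hf : Primrec f) (hg : Primrec g) :
    Primrec fun x => f (g x) := hf.comp hg

@[fun_prop] theorem Primrec.mk' {f : α → β} {g : α → γ} (hf : Primrec f) (hg : Primrec g) :
    Primrec fun x => (f x, g x) := hf.pair hg

@[fun_prop] theorem Primrec.fst' {f : α → β × γ} (hf : Primrec f) : Primrec fun x => (f x).1 :=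
  Primrec.fst.comp hf

@[fun_prop] theorem Primrec.snd' {f : α → β × γ} (hf : Primrec f) : Primrec fun x => (f x).2 :=
  Primrec.snd.comp hf

@[fun_prop] theorem Primrec.add' {f g : α → ℕ} (hf : Primrec f) (hg : Primrec g) :
    Primrec fun x => f x + g x := Primrec.nat_add.comp hf hg

@[fun_prop] theorem Primrec.sub' {f g : α → ℕ} (hf : Primrec f) (hg : Primrec g) :
    Primrec fun x => f x - g x := Primrec.nat_sub.comp hf hg

@[fun_prop] theorem Primrec.div' {f g : α → ℕ} (hf : Primrec f) (hg : Primrec g) :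
    Primrec fun x => f x / g x := Primrec.nat_div.comp hf hg

@[fun_prop] theorem Primrec.natPair' {f g : α → ℕ} (hf : Primrec f) (hg : Primrec g) :
    Primrec fun x => Nat.pair (f x) (g x) := Primrec₂.natPair.comp hf hg

@[fun_prop] theorem Primrec.list_getElem?' {f : α → List β} {g : α → ℕ} (hf : Primrec f)
    (hg : Primrec g) : Primrec fun x => (f x)[g x]? := Primrec.list_getElem?.comp hf hg

@[fun_prop] theorem Primrec.option_getD' {f : α → Option β} {g : α → β} (hf : Primrec f)
    (hg : Primrec g) : Primrec fun x => (f x).getD (g x) := Primrec.option_getD.comp hf hg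

@[fun_prop] theorem Primrec.option_some' {f : α → β} (hf : Primrec f) :
    Primrec fun x => some (f x) := Primrec.option_some.comp hf

@[fun_prop] theorem Primrec.list_getD' {f : α → List β} {g : α → ℕ} {d : β} (hf : Primrec f)
    (hg : Primrec g) : Primrec fun x => (f x).getD (g x) d :=
  (Primrec.list_getD d).comp hf hg

@[fun_prop] theorem Primrec.list_take' {f : α → List β} {g : α → ℕ} (hf : Primrec f)
    (hg : Primrec g) : Primrec fun x => (f x).take (g x) := Primrec.list_take.comp hg hf

@[fun_prop] theorem Primrec.list_append' {f g : α → List β} (hf : Primrec f)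
    (hg : Primrec g) : Primrec fun x => f x ++ g x := Primrec.list_append.comp hf hg

@[fun_prop] theorem Primrec.list_cons' {f : α → β} {g : α → List β} (hf : Primrec f)
    (hg : Primrec g) : Primrec fun x => f x :: g x := Primrec.list_cons.comp hf hg

@[fun_prop] theorem Primrec.decode' {f : α → ℕ} (hf : Primrec f) :
    Primrec fun x => (Encodable.decode (f x) : Option β) := Primrec.decode.comp hf

@[fun_prop] theorem Primrec.isSome' {f : α → Option β} (hf : Primrec f) :
    Primrec fun x => (f x).isSome := Primrec.option_isSome.comp hf

@[fun_prop] theorem Primrec.ite' {c : α → Prop} [DecidablePred c] {f g : α → β}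
    (hc : PrimrecPred c) (hf : Primrec f) (hg : Primrec g) :
    Primrec fun x => if c x then f x else g x := Primrec.ite hc hf hg

@[fun_prop] theorem PrimrecPred.eq' {f g : α → β} (hf : Primrec f) (hg : Primrec g) :
    PrimrecPred fun x => f x = g x := Primrec.eq.comp hf hg

@[fun_prop] theorem PrimrecPred.lt' {f g : α → ℕ} (hf : Primrec f) (hg : Primrec g) :
    PrimrecPred fun x => f x < g x := Primrec.nat_lt.comp hf hg

@[fun_prop] theorem PrimrecPred.le' {f g : α → ℕ} (hf : Primrec f) (hg : Primrec g) :
    PrimrecPred fun x => f x ≤ g x := Primrec.nat_le.comp hf hg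

attribute [fun_prop] PrimrecPred.and PrimrecPred.or PrimrecPred.not

theorem PrimrecPred.imp {p q : α → Prop} (hp : PrimrecPred p) (hq : PrimrecPred q) :
    PrimrecPred fun x => p x → q x :=
  (hp.not.or hq).of_eq fun x => by tauto

theorem PrimrecPred.bex {p : α → ℕ → Prop} {b : α → ℕ} (hb : Primrec b)
    (hp : PrimrecPred fun z : α × ℕ => p z.1 z.2) : PrimrecPred fun x => ∃ k < b x, p x k := by
  have h : PrimrecRel fun (k : ℕ) (x : α) => p x k := hp.comp (Primrec.snd.pair Primrec.fst)
  have := PrimrecRel.exists_mem_list h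
  refine (this.comp (Primrec.list_range.comp hb) Primrec.id).of_eq fun x => ?_
  simp

theorem PrimrecPred.ball {p : α → ℕ → Prop} {b : α → ℕ} (hb : Primrec b)
    (hp : PrimrecPred fun z : α × ℕ => p z.1 z.2) : PrimrecPred fun x => ∀ k < b x, p x k :=
  (PrimrecPred.bex (p := fun x k => ¬ p x k) hb hp.not).not.of_eq fun x => by simp

theorem PrimrecPred.const (p : Prop) : PrimrecPred fun _ : α => p := by
  classical exact ⟨inferInstance, Primrec.const (decide p)⟩

end PrimrecClosure

/-! ### The arithmetical hierarchy over coded types -/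

/-- The arithmetical classes over an arbitrary primitively coded type: level `0` consists of the
primitive recursive predicates, and level `n + 1` of the predicates `∃ y, ¬ q (x, y)` with `q` of
level `n`. -/
def Sg : ℕ → ∀ {α : Type} [Primcodable α], (α → Prop) → Prop
  | 0, _, _, p => PrimrecPred p
  | n + 1, α, _, p => ∃ q : α × ℕ → Prop, Sg n q ∧ ∀ x, p x ↔ ∃ y, ¬ q (x, y)

namespace Sg

variable {α β γ : Type} [Primcodable α] [Primcodable β] [Primcodable γ] {n : ℕ}

theorem of_eq {p q : α → Prop} (h : Sg n p) (H : ∀ x, p x ↔ q x) : Sg n q :=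
  (funext fun x => propext (H x) : p = q) ▸ h

theorem of_primrec {p : α → Prop} (h : PrimrecPred p) : Sg n p := by
  induction n generalizing α with
  | zero => exact h
  | succ n ih => exact ⟨fun z => ¬ p z.1, ih (h.comp Primrec.fst).not, fun x => by simp⟩

theorem comp {p : α → Prop} {f : β → α} (h : Sg n p) (hf : Primrec f) : Sg n fun x => p (f x) := by
  induction n generalizing α β with
  | zero => exact PrimrecPred.comp h hf
  | succ n ih =>
    obtain ⟨q, hq, H⟩ := h
    exact ⟨fun z => q (f z.1, z.2), ih hq (by fun_prop), fun x => H _⟩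

/-- The two closures are proved together because each level negates the one below, which exchanges
conjunction and disjunction. -/
theorem and_or {p q : α → Prop} (hp : Sg n p) (hq : Sg n q) :
    (Sg n fun x => p x ∧ q x) ∧ Sg n fun x => p x ∨ q x := by
  induction n generalizing α with
  | zero => exact ⟨PrimrecPred.and hp hq, PrimrecPred.or hp hq⟩
  | succ n ih =>
    obtain ⟨p', hp', Hp⟩ := hp
    obtain ⟨q', hq', Hq⟩ := hq
    refine ⟨⟨fun z => p' (z.1, z.2.unpair.1) ∨ q' (z.1, z.2.unpair.2),
      (ih (hp'.comp (by fun_prop)) (hq'.comp (by fun_prop))).2, fun x => ?_⟩,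
      ⟨fun z => p' z ∧ q' z, (ih hp' hq').1, fun x => ?_⟩⟩
    · simp only [Hp, Hq]
      constructor
      · rintro ⟨⟨a, ha⟩, b, hb⟩
        exact ⟨Nat.pair a b, by simp [ha, hb]⟩
      · rintro ⟨y, hy⟩
        push Not at hy
        exact ⟨⟨_, hy.1⟩, _, hy.2⟩
    · simp only [Hp, Hq, not_and_or, exists_or]

theorem and {p q : α → Prop} (hp : Sg n p) (hq : Sg n q) : Sg n fun x => p x ∧ q x :=
  (and_or hp hq).1

theorem or {p q : α → Prop} (hp : Sg n p) (hq : Sg n q) : Sg n fun x => p x ∨ q x :=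
  (and_or hp hq).2

theorem not {p : α → Prop} (hp : Sg n p) : Sg (n + 1) fun x => ¬ p x :=
  ⟨fun z => p z.1, hp.comp Primrec.fst, fun x => by simp⟩

theorem succ {p : α → Prop} (hp : Sg n p) : Sg (n + 1) p := by
  induction n generalizing α with
  | zero => exact of_primrec hp
  | succ n ih =>
    obtain ⟨q, hq, H⟩ := hp
    exact ⟨q, ih hq, H⟩

theorem mono {p : α → Prop} {m : ℕ} (hp : Sg n p) (h : n ≤ m) : Sg m p := by
  induction h with
  | refl => exact hp
  | step _ ih => exact ih.succ

theorem exNat {p : α → ℕ → Prop} (hp : Sg (n + 1) fun z : α × ℕ => p z.1 z.2) :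
    Sg (n + 1) fun x => ∃ y, p x y := by
  obtain ⟨q, hq, H⟩ := hp
  refine ⟨fun z => q ((z.1, z.2.unpair.1), z.2.unpair.2), hq.comp (by fun_prop), fun x => ?_⟩
  have := fun y => H (x, y)
  simp only at this
  simp only [this]
  constructor
  · rintro ⟨y, w, h⟩
    exact ⟨Nat.pair y w, by simpa using h⟩
  · rintro ⟨y, h⟩
    exact ⟨_, _, h⟩

theorem ex {p : α → β → Prop} (hp : Sg (n + 1) fun z : α × β => p z.1 z.2) :
    Sg (n + 1) fun x => ∃ y, p x y := by
  rcases isEmpty_or_nonempty β with h | ⟨⟨b₀⟩⟩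
  · exact (of_primrec (PrimrecPred.const False)).of_eq fun x => by simp
  · have : Sg (n + 1) fun x : α => ∃ m : ℕ, p x ((Encodable.decode m : Option β).getD b₀) :=
      exNat (hp.comp (f := fun z : α × ℕ => (z.1, (Encodable.decode z.2 : Option β).getD b₀))
        (by fun_prop))
    refine this.of_eq fun x => ⟨fun ⟨m, h⟩ => ⟨_, h⟩, fun ⟨b, h⟩ => ⟨Encodable.encode b, ?_⟩⟩
    simpa using h

/-- For the bounded universal quantifier, finitely many witnesses are collected in one list. The
matrix is negated, so the step for `∀` uses the case of `∃` one level down. -/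
theorem bex_ball {p : α → ℕ → Prop} {b : α → ℕ} (hb : Primrec b)
    (hp : Sg n fun z : α × ℕ => p z.1 z.2) :
    (Sg n fun x => ∃ k < b x, p x k) ∧ Sg n fun x => ∀ k < b x, p x k := by
  induction n generalizing α with
  | zero => exact ⟨PrimrecPred.bex hb hp, PrimrecPred.ball hb hp⟩
  | succ n ih =>
    refine ⟨?_, ?_⟩
    · refine exNat (and (of_primrec ?_) hp)
      fun_prop
    · obtain ⟨q, hq, H⟩ := hp
      have h1 : Sg n fun z : α × List ℕ => ∃ k < b z.1, q ((z.1, k), z.2.getD k 0) :=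
        (ih (b := fun z : α × List ℕ => b z.1) (by fun_prop)
          (hq.comp (f := fun w : (α × List ℕ) × ℕ => ((w.1.1, w.2), w.1.2.getD w.2 0))
          (by fun_prop))).1
      refine (ex (p := fun x (l : List ℕ) => ¬ ∃ k < b x, q ((x, k), l.getD k 0)) h1.not).of_eq ?_
      intro x
      have H' := fun k => H (x, k)
      simp only at H'
      constructor
      · rintro ⟨l, h⟩ k hk
        rw [H']
        exact ⟨_, fun h' => h ⟨k, hk, h'⟩⟩
      · intro h
        have : ∀ k, ∃ y, k < b x → ¬ q ((x, k), y) := fun k => by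
          by_cases hk : k < b x
          · obtain ⟨y, hy⟩ := (H' k).1 (h k hk)
            exact ⟨y, fun _ => hy⟩
          · exact ⟨0, fun h => absurd h hk⟩
        choose w hw using this
        refine ⟨(List.range (b x)).map w, ?_⟩
        rintro ⟨k, hk, h'⟩
        apply hw k hk
        simpa [List.getD, hk] using h'

theorem bex {p : α → ℕ → Prop} {b : α → ℕ} (hb : Primrec b)
    (hp : Sg n fun z : α × ℕ => p z.1 z.2) : Sg n fun x => ∃ k < b x, p x k := (bex_ball hb hp).1

theorem ball {p : α → ℕ → Prop} {b : α → ℕ} (hb : Primrec b)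
    (hp : Sg n fun z : α × ℕ => p z.1 z.2) : Sg n fun x => ∀ k < b x, p x k := (bex_ball hb hp).2

/-- A predicate of a value of a function whose graph is in the class. -/
theorem graph {p : α → β → Prop} {f : α → β} (hp : Sg (n + 1) fun z : α × β => p z.1 z.2)
    (hf : Sg (n + 1) fun z : α × β => f z.1 = z.2) : Sg (n + 1) fun x => p x (f x) :=
  (ex (p := fun x y => f x = y ∧ p x y) (hf.and hp)).of_eq fun x => by simp

end Sg

theorem REPred.exists_code {α : Type} [Primcodable α] {p : α → Prop} (h : REPred p) :
    ∃ c : Nat.Partrec.Code, ∀ x, p x ↔ (c.eval (Encodable.encode x)).Dom := by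
  obtain ⟨c, hc⟩ := Nat.Partrec.Code.exists_code.1 h
  refine ⟨c, fun x => ?_⟩
  rw [hc]
  simp [Part.assert]

theorem REPred.sg {α : Type} [Primcodable α] {p : α → Prop} (h : REPred p) : Sg 1 p := by
  obtain ⟨c, hc⟩ := h.exists_code
  -- `Sg` negates the matrix, so the matrix says that the computation has not halted yet.
  refine ⟨fun z => ¬ (Nat.Partrec.Code.evaln z.2 c (Encodable.encode z.1)).isSome = true, ?_, ?_⟩
  · have : Primrec fun z : α × ℕ => Nat.Partrec.Code.evaln z.2 c (Encodable.encode z.1) :=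
      Nat.Partrec.Code.primrec_evaln.comp
        (f := fun a : (ℕ × Nat.Partrec.Code) × ℕ => Nat.Partrec.Code.evaln a.1.1 a.1.2 a.2)
        (g := fun z : α × ℕ => ((z.2, c), Encodable.encode z.1)) (by fun_prop)
    show PrimrecPred _
    fun_prop
  · intro x
    rw [hc, Part.dom_iff_mem]
    simp only [Nat.Partrec.Code.evaln_complete, not_not, Option.isSome_iff_exists]
    exact exists_comm

theorem Sg.rePred {α : Type} [Primcodable α] {p : α → Prop} (h : Sg 1 p) : REPred p := by
  obtain ⟨q, ⟨hd, hq⟩, H⟩ := h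
  have : Partrec fun x => Nat.rfind fun y => Part.some (! decide (q (x, y))) :=
    Partrec.rfind (Primrec.not.comp hq).to_comp.partrec.to₂
  refine this.dom_re.of_eq fun x => ?_
  rw [H]
  refine (Nat.rfind_dom (p := fun y => Part.some (! decide (q (x, y))))).trans ?_
  simp

theorem ComputablePred.sg {α : Type} [Primcodable α] {p : α → Prop} (h : ComputablePred p) :
    Sg 1 p := h.to_re.sg

theorem ComputablePred.sg_not {α : Type} [Primcodable α] {p : α → Prop} (h : ComputablePred p) :
    Sg 1 fun x => ¬ p x := h.not.to_re.sg

/-- The arithmetical hierarchy over computable predicates and over primitive recursive ones agree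
from the first level on. -/
theorem isSigmaZero_succ_iff_sg {n : ℕ} {A : Set ℕ} :
    IsSigmaZero (n + 1) A ↔ Sg (n + 1) fun x => x ∈ A := by
  induction n generalizing A with
  | zero =>
    constructor
    · rintro ⟨B, hB, H⟩
      have hB : ComputablePred fun x => x ∈ B := hB
      refine (Sg.ex (p := fun x y => Nat.pair x y ∉ B)
        (hB.sg_not.comp (f := fun z : ℕ × ℕ => Nat.pair z.1 z.2) (by fun_prop))).of_eq fun x => ?_
      exact (H x).symm
    · rintro ⟨q, hq, H⟩
      refine ⟨{z | q z.unpair}, ?_, fun x => by simpa using H x⟩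
      obtain ⟨_, h⟩ : PrimrecPred fun z : ℕ => q z.unpair := PrimrecPred.comp hq Primrec.unpair
      exact ⟨_, h.to_comp⟩
  | succ n ih =>
    constructor
    · rintro ⟨B, hB, H⟩
      rw [ih] at hB
      exact ⟨fun z => Nat.pair z.1 z.2 ∈ B,
        hB.comp (f := fun z : ℕ × ℕ => Nat.pair z.1 z.2) (by fun_prop), H⟩
    · rintro ⟨q, hq, H⟩
      exact ⟨{z | q z.unpair}, ih.2 (hq.comp Primrec.unpair), fun x => by simpa using H x⟩

/-! ### Uniformization and dependent choice within a class -/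

namespace Sg

variable {α β : Type} [Primcodable α] [Primcodable β] {m : ℕ}

/-- A relation of class `m + 1` has a single-valued subrelation of the same class with the same
domain. -/
theorem uniformization {P : α → β → Prop} (hP : Sg (m + 1) fun z : α × β => P z.1 z.2) :
    ∃ P' : α → β → Prop, (Sg (m + 1) fun z : α × β => P' z.1 z.2) ∧ (∀ x y, P' x y → P x y) ∧
      (∀ x y y', P' x y → P' x y' → y = y') ∧ ∀ x, (∃ y, P x y) → ∃ y, P' x y := by
  classical
  rcases isEmpty_or_nonempty β with h | ⟨⟨b₀⟩⟩
  · exact ⟨P, hP, fun _ _ h => h, fun _ y => h.elim y, fun _ h => h⟩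
  obtain ⟨q, hq, H⟩ := hP
  let dec : ℕ → β := fun u => (Encodable.decode u.unpair.1 : Option β).getD b₀
  have hdec : Primrec dec := by fun_prop
  let N : α × ℕ → Prop := fun z => q ((z.1, dec z.2), z.2.unpair.2)
  have hN : Sg m N := hq.comp (by fun_prop)
  -- `u` codes a value together with its witness. Leastness of `u` stays in class `m + 1`, since `N`
  -- has class `m` and the quantifier over smaller codes is bounded.
  let Lst : α × ℕ → Prop := fun z => ¬ N z ∧ ∀ u < z.2, N (z.1, u)
  have hL : Sg (m + 1) Lst := hN.not.and (ball
    (p := fun (z : α × ℕ) u => N (z.1, u)) (b := fun z => z.2)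
    (by fun_prop) (hN.succ.comp (f := fun w : (α × ℕ) × ℕ => (w.1.1, w.2)) (by fun_prop)))
  have huniq : ∀ x u u', Lst (x, u) → Lst (x, u') → u = u' := by
    intro x u u' h h'
    rcases lt_trichotomy u u' with hlt | rfl | hlt
    · exact absurd (h'.2 u hlt) h.1
    · rfl
    · exact absurd (h.2 u' hlt) h'.1
  refine ⟨fun x y => ∃ u, Lst (x, u) ∧ dec u = y, ?_, ?_, ?_, ?_⟩
  · exact ex (p := fun (z : α × β) u => Lst (z.1, u) ∧ dec u = z.2)
      ((hL.comp (f := fun w : (α × β) × ℕ => (w.1.1, w.2)) (by fun_prop)).and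
        (of_primrec (by fun_prop)))
  · rintro x y ⟨u, ⟨h, -⟩, rfl⟩
    exact (H (x, dec u)).2 ⟨_, h⟩
  · rintro x y y' ⟨u, h, rfl⟩ ⟨u', h', rfl⟩
    rw [huniq x u u' h h']
  · rintro x ⟨y, hy⟩
    obtain ⟨w, hw⟩ := (H (x, y)).1 hy
    have hex : ∃ u, ¬ N (x, u) := ⟨Nat.pair (Encodable.encode y) w, by simpa [N, dec] using hw⟩
    exact ⟨_, Nat.find hex, ⟨Nat.find_spec hex, fun u hu => by
      simpa using Nat.find_min hex hu⟩, rfl⟩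

theorem choice {P : α → β → Prop} (hP : Sg (m + 1) fun z : α × β => P z.1 z.2)
    (h : ∀ x, ∃ y, P x y) :
    ∃ f : α → β, (∀ x, P x (f x)) ∧ Sg (m + 1) fun z : α × β => f z.1 = z.2 := by
  obtain ⟨P', hP', h1, h2, h3⟩ := uniformization hP
  choose f hf using fun x => h3 x (h x)
  exact ⟨f, fun x => h1 _ _ (hf x), hP'.of_eq fun z =>
    ⟨fun h => h2 _ _ _ (hf _) h, fun h => by rw [← h]; exact hf _⟩⟩

/-- After uniformization the sequence is determined by its start, so a finite list of earlier values
certifies each value. This keeps the graph in the class of `R`, with no condition on the complexity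
of `D`. -/
theorem dependentChoice {R : α → α → Prop} (hR : Sg (m + 1) fun z : α × α => R z.1 z.2)
    {D : α → Prop} {a : α} (ha : D a) (h1 : ∀ x, D x → ∃ y, R x y)
    (h2 : ∀ x y, D x → R x y → D y) :
    ∃ f : ℕ → α, f 0 = a ∧ (∀ j, R (f j) (f (j + 1))) ∧ (∀ j, D (f j)) ∧
      Sg (m + 1) fun z : ℕ × α => f z.1 = z.2 := by
  obtain ⟨R', hR', hsub, huniq, hex⟩ := uniformization hR
  have hstep : ∀ x : Subtype D, ∃ y : Subtype D, R' x y := fun x => by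
    obtain ⟨y, hy⟩ := hex x (h1 x x.2)
    exact ⟨⟨y, h2 _ _ x.2 (hsub _ _ hy)⟩, hy⟩
  choose s hs using hstep
  let F : ℕ → Subtype D := fun j => s^[j] ⟨a, ha⟩
  have hF : ∀ j, R' (F j) (F (j + 1)) := fun j => by
    simp only [F, Function.iterate_succ_apply']; exact hs _
  refine ⟨fun j => F j, rfl, fun j => hsub _ _ (hF j), fun j => (F j).2, ?_⟩
  have hg : Sg (m + 1) fun z : ℕ × α => ∃ l : List α, l.getD 0 a = a ∧ l.getD z.1 a = z.2 ∧
      ∀ k < z.1, R' (l.getD k a) (l.getD (k + 1) a) := by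
    refine ex (p := fun (z : ℕ × α) (l : List α) => l.getD 0 a = a ∧ l.getD z.1 a = z.2 ∧
      ∀ k < z.1, R' (l.getD k a) (l.getD (k + 1) a))
      ((of_primrec (by fun_prop)).and ((of_primrec (by fun_prop)).and ?_))
    exact ball (p := fun (w : (ℕ × α) × List α) k => R' (w.2.getD k a) (w.2.getD (k + 1) a))
      (b := fun w => w.1.1) (by fun_prop)
      (hR'.comp (f := fun w : ((ℕ × α) × List α) × ℕ => (w.1.2.getD w.2 a, w.1.2.getD (w.2 + 1) a))
        (by fun_prop))
  refine hg.of_eq fun ⟨j, y⟩ => ?_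
  constructor
  · rintro ⟨l, h0, hj, hk⟩
    have : ∀ k ≤ j, (F k : α) = l.getD k a := by
      intro k
      induction k with
      | zero => intro _; exact h0.symm
      | succ k ih =>
        intro hkj
        have hr := hk k hkj
        rw [← ih (by omega)] at hr
        exact huniq _ _ _ (hF k) hr
    exact (this j le_rfl).trans hj
  · intro h
    refine ⟨(List.range (j + 1)).map fun k => (F k : α), ?_, ?_, ?_⟩
    · simp [List.getD, F]
    · simpa [List.getD] using h
    · intro k hk
      have e1 : k < j + 1 := by omega
      simpa [List.getD, hk, e1] using hF k

end Sg

/-! ### Definable descent and least elements -/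

namespace ComputableLinearOrder

variable (L : ComputableLinearOrder)

/-- The strict order as a relation on all natural numbers. -/
def Lt (a b : ℕ) : Prop := a ∈ L.carrier ∧ b ∈ L.carrier ∧ L.lt a b

theorem sg_Lt {n : ℕ} : Sg (n + 1) fun p : ℕ × ℕ => L.Lt p.1 p.2 :=
  L.lt_computable.sg.mono (by omega)

theorem sg_not_Lt {n : ℕ} : Sg (n + 1) fun p : ℕ × ℕ => ¬ L.Lt p.1 p.2 :=
  L.lt_computable.sg_not.mono (by omega)

variable {L}

theorem Lt.irrefl {a : ℕ} : ¬ L.Lt a a := fun h => L.lt_irrefl a h.1 h.2.2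

theorem Lt.trans {a b c : ℕ} (h : L.Lt a b) (h' : L.Lt b c) : L.Lt a c :=
  ⟨h.1, h'.2.1, L.lt_trans a h.1 b h.2.1 c h'.2.1 h.2.2 h'.2.2⟩

theorem Lt.asymm {a b : ℕ} (h : L.Lt a b) : ¬ L.Lt b a := fun h' => (h.trans h').irrefl

theorem Lt.or_of_left {a b c : ℕ} (h : L.Lt a c) (hb : b ∈ L.carrier) : L.Lt a b ∨ L.Lt b c := by
  by_cases e : a = b
  · exact .inr (e ▸ h)
  · rcases L.lt_total a h.1 b hb e with h' | h'
    · exact .inl ⟨h.1, hb, h'⟩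
    · exact .inr (Lt.trans ⟨hb, h.1, h'⟩ h)

theorem not_Lt_trans {a b c : ℕ} (hb : b ∈ L.carrier) (h : ¬ L.Lt a b) (h' : ¬ L.Lt b c) :
    ¬ L.Lt a c := fun hac => (hac.or_of_left hb).elim h h'

theorem isDescending_iff {f : ℕ → ℕ} : L.IsDescending f ↔ ∀ k, L.Lt (f (k + 1)) (f k) :=
  ⟨fun h k => ⟨(h (k + 1)).1, (h k).1, (h k).2⟩, fun h k => ⟨(h k).2.1, (h k).2.2⟩⟩

/-- If no descending sequence has a graph of class `m + 1`, then every nonempty set of class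
`m + 1` of elements of the order has a least element. -/
theorem exists_least {m : ℕ}
    (hL : ¬ ∃ f, L.IsDescending f ∧ Sg (m + 1) fun z : ℕ × ℕ => f z.1 = z.2)
    {α : Type} [Primcodable α] {v : α → ℕ} (hv : Sg (m + 1) fun z : α × ℕ => v z.1 = z.2)
    {P : α → Prop} (hP : Sg (m + 1) P) (hne : ∃ a, P a) :
    ∃ a, P a ∧ ∀ b, P b → ¬ L.Lt (v b) (v a) := by
  by_contra! hcon
  apply hL
  obtain ⟨a, ha⟩ := hne
  let Q : ℕ → Prop := fun u => ∃ a, v a = u ∧ P a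
  have hQ : Sg (m + 1) Q := Sg.ex (p := fun u a => v a = u ∧ P a)
    ((hv.comp (f := fun z : ℕ × α => (z.2, z.1)) (by fun_prop)).and (hP.comp (by fun_prop)))
  obtain ⟨f, -, hf, -, hg⟩ := Sg.dependentChoice (R := fun x y => Q y ∧ L.Lt y x)
    ((hQ.comp (f := fun z : ℕ × ℕ => z.2) (by fun_prop)).and
      (L.sg_Lt.comp (f := fun z : ℕ × ℕ => (z.2, z.1)) (by fun_prop)))
    (D := Q) (a := v a) ⟨a, rfl, ha⟩
    (by
      rintro _ ⟨a, rfl, ha⟩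
      obtain ⟨b, hb, h⟩ := hcon a ha
      exact ⟨v b, ⟨b, rfl, hb⟩, h⟩)
    (fun _ _ _ h => h.1)
  exact ⟨f, isDescending_iff.2 fun k => (hf k).2, hg⟩

end ComputableLinearOrder

/-! ### Relative enumerability and Turing reducibility -/

/-- The list of the first `k` values of a function. -/
def initSeg {β : Type} (F : ℕ → β) (k : ℕ) : List β := (List.range k).map F

section InitSeg

variable {β : Type} (F : ℕ → β)

@[simp] theorem length_initSeg (k : ℕ) : (initSeg F k).length = k := by simp [initSeg]

theorem getElem?_initSeg (k j : ℕ) : (initSeg F k)[j]? = if j < k then some (F j) else none := by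
  simp only [initSeg, List.getElem?_map]
  split_ifs with h <;> simp [h]

theorem getD_initSeg (k j : ℕ) (d : β) :
    (initSeg F k).getD j d = if j < k then F j else d := by
  rw [List.getD_eq_getElem?_getD, getElem?_initSeg]
  split_ifs <;> rfl

theorem take_initSeg {j k : ℕ} (h : j ≤ k) : (initSeg F k).take j = initSeg F j := by
  apply List.ext_getElem?
  intro i
  rw [List.getElem?_take, getElem?_initSeg, getElem?_initSeg]
  split_ifs <;> first | rfl | omega

theorem initSeg_succ (k : ℕ) : initSeg F (k + 1) = initSeg F k ++ [F k] := by
  simp [initSeg, List.range_succ]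

end InitSeg

/-- `P` is computably enumerable relative to `F`: membership is witnessed by a finite initial
segment of `F`. -/
def CE (F : ℕ → ℕ) {α : Type} [Primcodable α] (P : α → Prop) : Prop :=
  ∃ Φ : List ℕ × α → Prop, Sg 1 Φ ∧ ∀ x, P x ↔ ∃ k, Φ (initSeg F k, x)

namespace CE

variable {α β : Type} [Primcodable α] [Primcodable β] {F : ℕ → ℕ} {P Q : α → Prop}

theorem of_eq (h : CE F P) (H : ∀ x, P x ↔ Q x) : CE F Q :=
  (funext fun x => propext (H x) : P = Q) ▸ h

theorem of_sg (h : Sg 1 P) : CE F P :=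
  ⟨fun z => P z.2, h.comp (by fun_prop), fun x => by simp⟩

theorem of_primrec (h : PrimrecPred P) : CE F P := of_sg (.of_primrec h)

/-- Accepting whatever a shorter prefix already accepts makes acceptance persist, so finitely many
prefixes can be replaced by the longest one. -/
theorem exists_mono (h : CE F P) :
    ∃ Φ : List ℕ × α → Prop, Sg 1 Φ ∧ (∀ x, P x ↔ ∃ k, Φ (initSeg F k, x)) ∧
      ∀ x j k, j ≤ k → Φ (initSeg F j, x) → Φ (initSeg F k, x) := by
  obtain ⟨Φ, hΦ, H⟩ := h
  have key : ∀ k x, (∃ j < (initSeg F k).length + 1, Φ ((initSeg F k).take j, x)) ↔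
      ∃ j ≤ k, Φ (initSeg F j, x) := by
    intro k x
    simp only [length_initSeg, Nat.lt_succ_iff]
    exact exists_congr fun j => and_congr_right fun hj => by rw [take_initSeg F hj]
  refine ⟨fun z => ∃ j < z.1.length + 1, Φ (z.1.take j, z.2),
    Sg.bex (p := fun (z : List ℕ × α) j => Φ (z.1.take j, z.2))
      (b := fun z : List ℕ × α => z.1.length + 1) (by fun_prop)
      (hΦ.comp (f := fun w : (List ℕ × α) × ℕ => (w.1.1.take w.2, w.1.2)) (by fun_prop)), ?_, ?_⟩
  · intro x
    simp only [key, H]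
    exact ⟨fun ⟨k, h⟩ => ⟨k, k, le_rfl, h⟩, fun ⟨_, j, _, h⟩ => ⟨j, h⟩⟩
  · intro x j k hjk
    simp only [key]
    rintro ⟨i, hi, h⟩
    exact ⟨i, hi.trans hjk, h⟩

theorem comp {f : β → α} (h : CE F P) (hf : Primrec f) : CE F fun x => P (f x) := by
  obtain ⟨Φ, hΦ, H⟩ := h
  exact ⟨fun z => Φ (z.1, f z.2), hΦ.comp (by fun_prop), fun x => H _⟩

theorem and (hP : CE F P) (hQ : CE F Q) : CE F fun x => P x ∧ Q x := by
  obtain ⟨Φ, hΦ, H, hm⟩ := hP.exists_mono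
  obtain ⟨Ψ, hΨ, H', hm'⟩ := hQ.exists_mono
  refine ⟨fun z => Φ z ∧ Ψ z, hΦ.and hΨ, fun x => ?_⟩
  simp only [H, H']
  constructor
  · rintro ⟨⟨j, hj⟩, k, hk⟩
    exact ⟨max j k, hm _ _ _ (le_max_left _ _) hj, hm' _ _ _ (le_max_right _ _) hk⟩
  · rintro ⟨k, h, h'⟩
    exact ⟨⟨k, h⟩, k, h'⟩

theorem or (hP : CE F P) (hQ : CE F Q) : CE F fun x => P x ∨ Q x := by
  obtain ⟨Φ, hΦ, H⟩ := hP
  obtain ⟨Ψ, hΨ, H'⟩ := hQ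
  exact ⟨fun z => Φ z ∨ Ψ z, hΦ.or hΨ, fun x => by simp only [H, H', exists_or]⟩

theorem ex {P : α → β → Prop} (h : CE F fun z : α × β => P z.1 z.2) :
    CE F fun x => ∃ y, P x y := by
  obtain ⟨Φ, hΦ, H⟩ := h
  refine ⟨fun z => ∃ y, Φ (z.1, (z.2, y)), Sg.ex (p := fun (z : List ℕ × α) y => Φ (z.1, (z.2, y)))
    (hΦ.comp (f := fun w : (List ℕ × α) × β => (w.1.1, (w.1.2, w.2))) (by fun_prop)), fun x => ?_⟩
  simp only [fun y => H (x, y)]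
  exact exists_comm

theorem ball {P : α → ℕ → Prop} {b : α → ℕ} (hb : Primrec b)
    (h : CE F fun z : α × ℕ => P z.1 z.2) : CE F fun x => ∀ k < b x, P x k := by
  obtain ⟨Φ, hΦ, H, hm⟩ := h.exists_mono
  refine ⟨fun z => ∀ j < b z.2, Φ (z.1, (z.2, j)),
    Sg.ball (p := fun (z : List ℕ × α) j => Φ (z.1, (z.2, j))) (b := fun z : List ℕ × α => b z.2)
      (by fun_prop)
      (hΦ.comp (f := fun w : (List ℕ × α) × ℕ => (w.1.1, (w.1.2, w.2))) (by fun_prop)),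
    fun x => ?_⟩
  have H' := fun k => H (x, k)
  simp only at H'
  simp only [H']
  constructor
  · intro h
    have : ∀ j, ∃ k, j < b x → Φ (initSeg F k, (x, j)) := fun j => by
      by_cases hj : j < b x
      · obtain ⟨k, hk⟩ := h j hj
        exact ⟨k, fun _ => hk⟩
      · exact ⟨0, fun h => absurd h hj⟩
    choose w hw using this
    exact ⟨(Finset.range (b x)).sup w, fun j hj =>
      hm _ _ _ (Finset.le_sup (f := w) (Finset.mem_range.2 hj)) (hw j hj)⟩
  · rintro ⟨k, hk⟩ j hj
    exact ⟨k, hk j hj⟩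

theorem apply_eq {f g : α → ℕ} (hf : Primrec f) (hg : Primrec g) :
    CE F fun x => F (f x) = g x := by
  refine ⟨fun z => z.1[f z.2]? = some (g z.2), .of_primrec (by fun_prop), fun x => ?_⟩
  simp only [getElem?_initSeg]
  constructor
  · intro h
    exact ⟨f x + 1, by simp [h]⟩
  · rintro ⟨k, hk⟩
    split_ifs at hk
    exact Option.some.inj hk

/-- The graph of a partial function recursive in `F` is computably enumerable in `F`. -/
theorem of_recursiveIn {p : ℕ →. ℕ} (h : Nat.RecursiveIn {fun m => Part.some (F m)} p) :
    CE F fun z : ℕ × ℕ => z.2 ∈ p z.1 := by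
  induction h with
  | zero =>
    exact (of_primrec (P := fun z : ℕ × ℕ => z.2 = 0) (by fun_prop)).of_eq fun z =>
      Part.mem_some_iff.symm
  | succ =>
    exact (of_primrec (P := fun z : ℕ × ℕ => z.2 = z.1 + 1) (by fun_prop)).of_eq fun z =>
      Part.mem_some_iff.symm
  | left =>
    exact (of_primrec (P := fun z : ℕ × ℕ => z.2 = z.1.unpair.1) (by fun_prop)).of_eq fun z =>
      Part.mem_some_iff.symm
  | right =>
    exact (of_primrec (P := fun z : ℕ × ℕ => z.2 = z.1.unpair.2) (by fun_prop)).of_eq fun z =>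
      Part.mem_some_iff.symm
  | oracle g hg =>
    obtain rfl := Set.mem_singleton_iff.1 hg
    exact (apply_eq (f := fun z : ℕ × ℕ => z.1) (g := fun z : ℕ × ℕ => z.2) (by fun_prop)
      (by fun_prop)).of_eq fun z => by simp [eq_comm]
  | @pair f g _ _ hf hg =>
    refine ((hf.comp (f := fun z : ℕ × ℕ => (z.1, z.2.unpair.1)) (by fun_prop)).and
      (hg.comp (f := fun z : ℕ × ℕ => (z.1, z.2.unpair.2)) (by fun_prop))).of_eq fun z => ?_
    simp only [Seq.seq, Part.map_eq_map, Part.mem_bind_iff, Part.mem_map_iff]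
    constructor
    · rintro ⟨h1, h2⟩
      exact ⟨_, ⟨_, h1, rfl⟩, _, h2, by simp⟩
    · rintro ⟨_, ⟨a, ha, rfl⟩, b, hb, h⟩
      rw [← h]
      simpa using ⟨ha, hb⟩
  | @comp f g _ _ hf hg =>
    refine (ex (P := fun (z : ℕ × ℕ) a => a ∈ g z.1 ∧ z.2 ∈ f a)
      ((hg.comp (f := fun w : (ℕ × ℕ) × ℕ => (w.1.1, w.2)) (by fun_prop)).and
      (hf.comp (f := fun w : (ℕ × ℕ) × ℕ => (w.2, w.1.2)) (by fun_prop)))).of_eq fun z => ?_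
    exact Part.mem_bind_iff.symm
  | @prec f g _ _ hf hg =>
    -- The list `l` holds the successive values of the primitive recursion.
    refine (ex (P := fun (z : ℕ × ℕ) (l : List ℕ) => l.getD 0 0 ∈ f z.1.unpair.1 ∧
      l.getD z.1.unpair.2 0 = z.2 ∧ ∀ k < z.1.unpair.2, l.getD (k + 1) 0 ∈
        g (Nat.pair z.1.unpair.1 (Nat.pair k (l.getD k 0))))
      ((hf.comp (f := fun w : (ℕ × ℕ) × List ℕ => (w.1.1.unpair.1, w.2.getD 0 0))
        (by fun_prop)).and ((of_primrec (by fun_prop)).and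
        (ball (P := fun (w : (ℕ × ℕ) × List ℕ) k => w.2.getD (k + 1) 0 ∈
          g (Nat.pair w.1.1.unpair.1 (Nat.pair k (w.2.getD k 0))))
          (b := fun w : (ℕ × ℕ) × List ℕ => w.1.1.unpair.2) (by fun_prop)
          (hg.comp (f := fun u : ((ℕ × ℕ) × List ℕ) × ℕ =>
            (Nat.pair u.1.1.1.unpair.1 (Nat.pair u.2 (u.1.2.getD u.2 0)), u.1.2.getD (u.2 + 1) 0))
            (by fun_prop)))))).of_eq ?_
    rintro ⟨x, y⟩
    obtain ⟨a, n, rfl⟩ : ∃ a n, x = Nat.pair a n := ⟨x.unpair.1, x.unpair.2, by simp⟩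
    simp only [Nat.unpair_pair]
    induction n generalizing y with
    | zero =>
      constructor
      · rintro ⟨l, h1, h2, -⟩
        rw [← h2]; exact h1
      · intro h
        exact ⟨[y], by simpa using h, by simp, by simp⟩
    | succ n ih =>
      refine Iff.trans ?_ Part.mem_bind_iff.symm
      constructor
      · rintro ⟨l, h1, h2, h3⟩
        exact ⟨l.getD n 0, (ih _).1 ⟨l, h1, rfl, fun k hk => h3 k (by omega)⟩,
          h2 ▸ h3 n (by omega)⟩
      · rintro ⟨i, hi, h4⟩
        obtain ⟨l, h1, h2, h3⟩ := (ih _).2 hi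
        let l' := initSeg (fun k => if k ≤ n then l.getD k 0 else y) (n + 2)
        have e : ∀ k, k ≤ n → l'.getD k 0 = l.getD k 0 := fun k hk => by
          rw [getD_initSeg, if_pos (by omega), if_pos hk]
        have e' : l'.getD (n + 1) 0 = y := by
          rw [getD_initSeg, if_pos (by omega), if_neg (by omega)]
        refine ⟨l', by rwa [e 0 (by omega)], e', fun k hk => ?_⟩
        rw [e k (by omega)]
        rcases (show k < n ∨ k = n by omega) with hk | rfl
        · rw [e _ (by omega)]; exact h3 k hk
        · rw [e', h2]; exact h4
  | @rfind f _ hf =>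
    refine ((hf.comp (f := fun z : ℕ × ℕ => (Nat.pair z.1 z.2, 0)) (by fun_prop)).and
      (ball (P := fun (z : ℕ × ℕ) k => ∃ v, v ≠ 0 ∧ v ∈ f (Nat.pair z.1 k))
        (b := fun z : ℕ × ℕ => z.2) (by fun_prop)
        (ex (P := fun (w : (ℕ × ℕ) × ℕ) v => v ≠ 0 ∧ v ∈ f (Nat.pair w.1.1 w.2))
          ((of_primrec (by fun_prop)).and (hf.comp (f := fun u : ((ℕ × ℕ) × ℕ) × ℕ =>
            (Nat.pair u.1.1.1 u.1.2, u.2)) (by fun_prop)))))).of_eq ?_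
    rintro ⟨x, y⟩
    refine Iff.trans ?_ (Nat.mem_rfind (p := fun n => (fun m => decide (m = 0)) <$>
      f (Nat.pair x n))).symm
    simp only [Part.map_eq_map, Part.mem_map_iff]
    constructor
    · rintro ⟨h1, h2⟩
      refine ⟨⟨0, h1, by simp⟩, fun {m} hm => ?_⟩
      obtain ⟨v, hv, h⟩ := h2 m hm
      exact ⟨v, h, by simpa using hv⟩
    · rintro ⟨⟨a, ha, h⟩, h2⟩
      have : a = 0 := by simpa using h
      subst this
      refine ⟨ha, fun m hm => ?_⟩
      obtain ⟨v, hv, h⟩ := h2 hm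
      exact ⟨v, by simpa using h, hv⟩

end CE

section TotalRecursiveIn

variable {O : Set (ℕ →. ℕ)}

theorem Primrec.nat_recursiveIn {f : ℕ → ℕ} (hf : Primrec f) :
    Nat.RecursiveIn O fun m => Part.some (f m) :=
  (Primrec.nat_iff.1 hf).recursiveIn

theorem Nat.RecursiveIn.comp_total {f g : ℕ → ℕ} (hf : Nat.RecursiveIn O fun m => Part.some (f m))
    (hg : Nat.RecursiveIn O fun m => Part.some (g m)) :
    Nat.RecursiveIn O fun m => Part.some (f (g m)) :=
  (Nat.RecursiveIn.comp hf hg).of_eq fun m => by simp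

theorem Nat.RecursiveIn.pair_total {f g : ℕ → ℕ} (hf : Nat.RecursiveIn O fun m => Part.some (f m))
    (hg : Nat.RecursiveIn O fun m => Part.some (g m)) :
    Nat.RecursiveIn O fun m => Part.some (Nat.pair (f m) (g m)) :=
  (Nat.RecursiveIn.pair hf hg).of_eq fun m => by simp [Seq.seq]

theorem recursiveIn_encode_initSeg (F : ℕ → ℕ) :
    Nat.RecursiveIn {fun m => Part.some (F m)}
      fun m => Part.some (Encodable.encode (initSeg F m)) := by
  have hF : Nat.RecursiveIn {fun m => Part.some (F m)} fun m => Part.some (F m) :=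
    .oracle _ rfl
  have happ : Primrec fun z : ℕ => Encodable.encode
      (((Encodable.decode z.unpair.1 : Option (List ℕ)).getD []) ++ [z.unpair.2]) := by fun_prop
  have hstep := happ.nat_recursiveIn.comp_total
    ((show Primrec fun m : ℕ => m.unpair.2.unpair.2 by fun_prop).nat_recursiveIn.pair_total
      (hF.comp_total
        (show Primrec fun m : ℕ => m.unpair.2.unpair.1 by fun_prop).nat_recursiveIn))
  have hprec := Nat.RecursiveIn.prec
    (Primrec.const (α := ℕ) (Encodable.encode ([] : List ℕ))).nat_recursiveIn hstep
  refine (Nat.RecursiveIn.comp hprec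
    (show Primrec fun m : ℕ => Nat.pair 0 m by fun_prop).nat_recursiveIn).of_eq fun m => ?_
  simp only [Part.bind_eq_bind, Part.bind_some, Nat.unpair_pair]
  induction m with
  | zero => simp [initSeg]
  | succ m ih =>
    simp only [ih, Part.bind_some, Encodable.encodek, Option.getD_some,
      initSeg_succ]

end TotalRecursiveIn

theorem CE.recursiveIn {F h : ℕ → ℕ} (H : CE F fun z : ℕ × ℕ => h z.1 = z.2) :
    Nat.RecursiveIn {fun m => Part.some (F m)} fun m => Part.some (h m) := by
  classical
  obtain ⟨Φ, ⟨q, hq, Hq⟩, HΦ⟩ := H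
  have hq : PrimrecPred q := hq
  -- The search variable codes a prefix length, a value and a witness; `E` is `0` exactly when they
  -- certify the value. Every certified value is correct, so the first success suffices.
  let E : ℕ → ℕ := fun z => if q ((((Encodable.decode z.unpair.2 : Option (List ℕ)).getD []),
    (z.unpair.1.unpair.1, z.unpair.1.unpair.2.unpair.2.unpair.1)),
      z.unpair.1.unpair.2.unpair.2.unpair.2) then 1 else 0
  have hE : Primrec E := Primrec.ite (hq.comp (by fun_prop)) (by fun_prop) (by fun_prop)
  have hcheck := hE.nat_recursiveIn.comp_total ((Primrec.id.nat_recursiveIn.pair_total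
    ((recursiveIn_encode_initSeg F).comp_total
      (show Primrec fun m : ℕ => m.unpair.2.unpair.1 by fun_prop).nat_recursiveIn)))
  refine (Nat.RecursiveIn.comp
    (show Primrec fun m : ℕ => m.unpair.2.unpair.1 by fun_prop).nat_recursiveIn
    (Nat.RecursiveIn.rfind hcheck)).of_eq fun m => ?_
  rw [Part.eq_some_iff]
  simp only [Part.bind_eq_bind, Part.mem_bind_iff, Part.mem_some_iff]
  have key : ∀ u : ℕ, E (Nat.pair (id (Nat.pair m u)) (Encodable.encode
      (initSeg F (Nat.pair m u).unpair.2.unpair.1))) = 0 ↔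
      ¬ q ((initSeg F u.unpair.1, (m, u.unpair.2.unpair.1)), u.unpair.2.unpair.2) := by
    intro u
    simp [E]
  have hsound : ∀ u : ℕ,
      ¬ q ((initSeg F u.unpair.1, (m, u.unpair.2.unpair.1)), u.unpair.2.unpair.2) →
      h m = u.unpair.2.unpair.1 := fun u hu =>
    (HΦ (m, u.unpair.2.unpair.1)).2 ⟨_, (Hq _).2 ⟨_, hu⟩⟩
  have hex : ∃ u : ℕ,
      ¬ q ((initSeg F u.unpair.1, (m, u.unpair.2.unpair.1)), u.unpair.2.unpair.2) := by
    obtain ⟨k, hk⟩ := (HΦ (m, h m)).1 rfl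
    obtain ⟨t, ht⟩ := (Hq _).1 hk
    exact ⟨Nat.pair k (Nat.pair (h m) t), by simpa using ht⟩
  refine ⟨Nat.find hex, (Nat.mem_rfind (p := fun n => (fun m => decide (m = 0)) <$>
      Part.some (E (Nat.pair (id (Nat.pair m n)) (Encodable.encode
      (initSeg F (Nat.pair m n).unpair.2.unpair.1)))))).2 ⟨?_, fun {u} hu => ?_⟩,
      hsound _ (Nat.find_spec hex)⟩
  · simp only [Part.map_eq_map, Part.map_some, Part.mem_some_iff]
    exact (decide_eq_true ((key _).2 (Nat.find_spec hex))).symm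
  · simp only [Part.map_eq_map, Part.map_some, Part.mem_some_iff]
    exact (decide_eq_false (fun h => Nat.find_min hex hu ((key _).1 h))).symm

theorem setTuringReducible_iff {X : Set ℕ} {F : ℕ → ℕ} :
    SetTuringReducible X F ↔ CE F fun z : ℕ × ℕ => charFun X z.1 = z.2 := by
  refine Iff.trans (RecursiveIn.iff_nat (f := fun m => Part.some (charFun X m))) ?_
  exact ⟨fun h => (CE.of_recursiveIn h).of_eq fun z => by simp [eq_comm], CE.recursiveIn⟩

theorem setTuringReducible_of_ce {X : Set ℕ} {F : ℕ → ℕ} (h : CE F fun x => x ∈ X)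
    (h' : CE F fun x => x ∉ X) : SetTuringReducible X F := by
  rw [setTuringReducible_iff]
  refine (((h.comp (f := fun z : ℕ × ℕ => z.1) (by fun_prop)).and
    (.of_primrec (P := fun z : ℕ × ℕ => z.2 = 1) (by fun_prop))).or
    ((h'.comp (f := fun z : ℕ × ℕ => z.1) (by fun_prop)).and
    (.of_primrec (P := fun z : ℕ × ℕ => z.2 = 0) (by fun_prop)))).of_eq fun z => ?_
  unfold charFun
  split_ifs with hX <;> simp [hX, eq_comm]

/-! ### Splitting strings and ascending blocks -/

/-- Two strings differ for the first time at some position which is at least `t`. -/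
def Split (t : ℕ) (a b : List Bool) : Prop :=
  ∃ i < a.length, t ≤ i ∧ i < b.length ∧ a.take i = b.take i ∧ a[i]? ≠ b[i]?

namespace Split

theorem symm {t : ℕ} {a b : List Bool} : Split t a b → Split t b a :=
  fun ⟨i, h1, h2, h3, h4, h5⟩ => ⟨i, h3, h2, h1, h4.symm, h5.symm⟩

theorem mono {t u : ℕ} {a b : List Bool} (htu : t ≤ u) : Split u a b → Split t a b :=
  fun ⟨i, h1, h2, h⟩ => ⟨i, h1, htu.trans h2, h⟩

theorem lt_length {t : ℕ} {a b : List Bool} : Split t a b → t < a.length :=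
  fun ⟨_, h1, h2, _⟩ => h2.trans_lt h1

theorem primrec {α : Type} [Primcodable α] {t : α → ℕ} {a b : α → List Bool} (ht : Primrec t)
    (ha : Primrec a) (hb : Primrec b) : PrimrecPred fun x => Split (t x) (a x) (b x) :=
  PrimrecPred.bex (p := fun x i => t x ≤ i ∧ i < (b x).length ∧ (a x).take i = (b x).take i ∧
    (a x)[i]? ≠ (b x)[i]?) (b := fun x => (a x).length) (by fun_prop) (by fun_prop)

/-- Strings which agree below `t` and differ at some position split at a level at least `t`. -/
theorem of_ne {t i : ℕ} {a b : List Bool} (h : a.take t = b.take t) (ha : i < a.length)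
    (hb : i < b.length) (hne : a[i]? ≠ b[i]?) : Split t a b := by
  classical
  have hex : ∃ i, i < a.length ∧ i < b.length ∧ a[i]? ≠ b[i]? := ⟨i, ha, hb, hne⟩
  obtain ⟨h1, h2, h3⟩ := Nat.find_spec hex
  have hmin : ∀ j < Nat.find hex, a[j]? = b[j]? := fun j hj => by
    have := Nat.find_min hex hj
    by_contra hne
    exact this ⟨by omega, by omega, hne⟩
  refine ⟨Nat.find hex, h1, ?_, h2, ?_, h3⟩
  · by_contra! hlt
    have := congrArg (fun l => l[Nat.find hex]?) h
    simp only [List.getElem?_take, hlt, if_true] at this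
    exact h3 this
  · apply List.ext_getElem?
    intro j
    simp only [List.getElem?_take]
    split_ifs with hj
    · exact hmin j hj
    · rfl

end Split

theorem Sg.exists_interleave {α : Type} [Primcodable α] {m : ℕ} {h : ℕ → α × α}
    (hh : Sg (m + 1) fun z : ℕ × (α × α) => h z.1 = z.2) :
    ∃ g : ℕ → α, (Sg (m + 1) fun z : ℕ × α => g z.1 = z.2) ∧ (∀ t, g (2 * t) = (h t).1) ∧
      ∀ t, g (2 * t + 1) = (h t).2 := by
  refine ⟨fun x => if x % 2 = 0 then (h (x / 2)).1 else (h (x / 2)).2, ?_, fun t => by simp,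
    fun t => ?_⟩
  · have hmod : PrimrecPred fun w : (ℕ × α) × (α × α) => w.1.1 % 2 = 0 :=
      PrimrecPred.eq' (Primrec.nat_mod.comp (by fun_prop) (by fun_prop)) (by fun_prop)
    refine (Sg.graph (p := fun (z : ℕ × α) w => (z.1 % 2 = 0 ∧ w.1 = z.2) ∨
      (¬ z.1 % 2 = 0 ∧ w.2 = z.2)) (f := fun z => h (z.1 / 2)) (.of_primrec (by fun_prop))
      (hh.comp (f := fun w : (ℕ × α) × (α × α) => (w.1.1 / 2, w.2)) (by fun_prop))).of_eq
      fun z => ?_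
    dsimp only
    split_ifs with he <;> simp [he]
  · have h1 : (2 * t + 1) % 2 = 1 := by omega
    have h2 : (2 * t + 1) / 2 = t := by omega
    simp [h1, h2]

section Blocks

variable {L : ComputableLinearOrder} {m : ℕ} {s : ℕ → List Bool} {v : ℕ → ℕ}

/-- `g` selects a subsequence of blocks (pairs of consecutive terms) of the sequence `s`, which
split at increasing levels and on which `v` does not descend from one block to a later one. -/
def BlockAscending (L : ComputableLinearOrder) (s : ℕ → List Bool) (v g : ℕ → ℕ) : Prop :=
  (∀ x y, x / 2 < y / 2 → g x / 2 < g y / 2) ∧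
    (∀ t, Split t (s (g (2 * t))) (s (g (2 * t + 1)))) ∧
    ∀ x y, x / 2 < y / 2 → ¬ L.Lt (v (g y)) (v (g x))

/-- Dependent choice produces the blocks one after another. All four comparisons between consecutive
blocks are demanded, so that transitivity of "not below" extends them to all pairs of blocks. -/
theorem exists_blockAscending_of_step (hv : Sg (m + 1) fun z : ℕ × ℕ => v z.1 = z.2)
    (hc : ∀ a, v a ∈ L.carrier)
    {Ok : ℕ × ℕ × ℕ → Prop} (hOk : Sg (m + 1) Ok)
    (hsplit : ∀ j a b, Ok (j, a, b) → j ≤ a ∧ j ≤ b ∧ Split j (s a) (s b)) (h0 : ∃ z, Ok z)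
    (hstep : ∀ j a b, Ok (j, a, b) → ∀ J, ∃ j' a' b', Ok (j', a', b') ∧ J ≤ j' ∧
      ¬ L.Lt (v a') (v a) ∧ ¬ L.Lt (v b') (v a) ∧ ¬ L.Lt (v a') (v b) ∧ ¬ L.Lt (v b') (v b)) :
    ∃ g : ℕ → ℕ, (Sg (m + 1) fun z : ℕ × ℕ => g z.1 = z.2) ∧ BlockAscending L s v g := by
  obtain ⟨z₀, hz₀⟩ := h0
  let A : ℕ × ℕ → Prop := fun p => ¬ L.Lt (v p.1) (v p.2)
  have hA : Sg (m + 1) A :=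
    Sg.graph (p := fun (p : ℕ × ℕ) y => ¬ L.Lt (v p.1) y) (f := fun p => v p.2)
      (Sg.graph (p := fun (p : (ℕ × ℕ) × ℕ) y => ¬ L.Lt y p.2) (f := fun p => v p.1.1)
        (L.sg_not_Lt.comp (f := fun w : ((ℕ × ℕ) × ℕ) × ℕ => (w.2, w.1.2)) (by fun_prop))
        (hv.comp (f := fun w : ((ℕ × ℕ) × ℕ) × ℕ => (w.1.1.1, w.2)) (by fun_prop)))
      (hv.comp (f := fun w : (ℕ × ℕ) × ℕ => (w.1.2, w.2)) (by fun_prop))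
  -- New indices are at least the new level; starting it two past both old indices moves them to a
  -- later block `x / 2`.
  let R : ℕ × ℕ × ℕ → ℕ × ℕ × ℕ → Prop := fun z z' => Ok z' ∧
    (z.1 + 1 ≤ z'.1 ∧ z.2.1 + 2 ≤ z'.1 ∧ z.2.2 + 2 ≤ z'.1) ∧
    A (z'.2.1, z.2.1) ∧ A (z'.2.2, z.2.1) ∧ A (z'.2.1, z.2.2) ∧ A (z'.2.2, z.2.2)
  have hR : Sg (m + 1) fun w : (ℕ × ℕ × ℕ) × (ℕ × ℕ × ℕ) => R w.1 w.2 :=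
    (hOk.comp (by fun_prop)).and ((Sg.of_primrec (by fun_prop)).and
      ((hA.comp (by fun_prop)).and ((hA.comp (by fun_prop)).and
        ((hA.comp (by fun_prop)).and (hA.comp (by fun_prop))))))
  obtain ⟨h, -, hR', hD, hg⟩ := Sg.dependentChoice hR (D := Ok) hz₀
    (by
      rintro ⟨j, a, b⟩ hz
      obtain ⟨j', a', b', h1, h2, h3⟩ := hstep j a b hz (j + a + b + 2)
      exact ⟨(j', a', b'), h1, by dsimp only; omega, h3⟩)
    (fun _ _ _ h => h.1)
  have hS := fun t => hsplit _ _ _ (hD t)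
  have hj : ∀ t, t ≤ (h t).1 := by
    intro t
    induction t with
    | zero => omega
    | succ t ih => have := (hR' t).2.1.1; omega
  obtain ⟨g, hgg, e0, e1⟩ := Sg.exists_interleave (h := fun t => (h t).2)
    (Sg.graph (p := fun (z : ℕ × (ℕ × ℕ)) w => w.2 = z.2) (f := fun z => h z.1)
      (.of_primrec (by fun_prop))
      (hg.comp (f := fun w : (ℕ × (ℕ × ℕ)) × (ℕ × ℕ × ℕ) => (w.1.1, w.2)) (by fun_prop)))
  have hcase : ∀ x, g x = (h (x / 2)).2.1 ∨ g x = (h (x / 2)).2.2 := fun x => by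
    rcases Nat.mod_two_eq_zero_or_one x with hx | hx
    · left; rw [← e0]; congr 1; omega
    · right; rw [← e1]; congr 1; omega
  have hlow : ∀ x, (h (x / 2)).1 ≤ g x := fun x => by
    have := hS (x / 2)
    rcases hcase x with e | e <;> rw [e]
    exacts [this.1, this.2.1]
  refine ⟨g, hgg, ?_, ?_, ?_⟩
  · have hmono : ∀ t t', t < t' → ∀ x, x / 2 = t → g x + 2 ≤ (h t').1 := by
      intro t t' htt'
      induction htt' with
      | refl =>
        rintro x rfl
        have := (hR' (x / 2)).2.1
        rcases hcase x with e | e <;> rw [e]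
        exacts [this.2.1, this.2.2]
      | @step u _ ih =>
        intro x hx
        have := (hR' u).2.1.1
        exact (ih x hx).trans (show (h u).1 ≤ (h (u + 1)).1 by omega)
    intro x y hxy
    have h1 := hmono _ _ hxy x rfl
    have h2 := hlow y
    omega
  · intro t
    rw [e0, e1]
    exact (hS t).2.2.mono (hj t)
  · have hasc : ∀ t t', t < t' → ∀ x y, x / 2 = t → y / 2 = t' → ¬ L.Lt (v (g y)) (v (g x)) := by
      intro t t' htt'
      have hcons : ∀ x y, y / 2 = x / 2 + 1 → ¬ L.Lt (v (g y)) (v (g x)) := by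
        intro x y hxy
        obtain ⟨-, -, h1, h2, h3, h4⟩ := hR' (x / 2)
        rw [← hxy] at h1 h2 h3 h4
        rcases hcase x with e | e <;> rcases hcase y with e' | e' <;> rw [e, e'] <;> assumption
      induction htt' with
      | refl =>
        rintro x y rfl hy
        exact hcons x y hy
      | @step u _ ih =>
        intro x y hx hy
        refine ComputableLinearOrder.not_Lt_trans (hc (g (2 * u))) (hcons _ _ ?_)
          (ih x (2 * u) hx ?_) <;> omega
    intro x y hxy
    exact hasc _ _ hxy x y rfl rfl

/-- From a sequence of splitting blocks one computes, in one more jump, a subsequence of blocks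
which is also ascending in a given order without descending sequences of the given complexity. -/
theorem exists_blockAscending
    (hL : ¬ ∃ f, L.IsDescending f ∧ Sg (m + 1) fun z : ℕ × ℕ => f z.1 = z.2)
    (hs : Sg (m + 1) fun z : ℕ × List Bool => s z.1 = z.2)
    (hv : Sg (m + 1) fun z : ℕ × ℕ => v z.1 = z.2) (hc : ∀ a, v a ∈ L.carrier)
    (hsplit : ∀ t, Split t (s (2 * t)) (s (2 * t + 1))) :
    ∃ g : ℕ → ℕ, (Sg (m + 2) fun z : ℕ × ℕ => g z.1 = z.2) ∧ BlockAscending L s v g := by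
  classical
  let A : ℕ × ℕ → Prop := fun p => ¬ L.Lt (v p.1) (v p.2)
  have hvL : ∀ {p : ℕ × ℕ → Prop}, Sg (m + 1) p → Sg (m + 1) fun q : ℕ × ℕ => p (v q.1, v q.2) := by
    intro p hp
    exact Sg.graph (p := fun (q : ℕ × ℕ) y => p (v q.1, y)) (f := fun q => v q.2)
      (Sg.graph (p := fun (q : (ℕ × ℕ) × ℕ) y => p (y, q.2)) (f := fun q => v q.1.1)
        (hp.comp (f := fun w : ((ℕ × ℕ) × ℕ) × ℕ => (w.2, w.1.2)) (by fun_prop))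
        (hv.comp (f := fun w : ((ℕ × ℕ) × ℕ) × ℕ => (w.1.1.1, w.2)) (by fun_prop)))
      (hv.comp (f := fun w : (ℕ × ℕ) × ℕ => (w.1.2, w.2)) (by fun_prop))
  have hA : Sg (m + 1) A := hvL L.sg_not_Lt
  have hA' : Sg (m + 1) fun q : ℕ × ℕ => L.Lt (v q.1) (v q.2) := hvL L.sg_Lt
  let P : ℕ × ℕ × ℕ → Prop := fun z => z.1 ≤ z.2.1 ∧ z.1 ≤ z.2.2 ∧ Split z.1 (s z.2.1) (s z.2.2)
  have hP : Sg (m + 1) P := by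
    refine (Sg.of_primrec (by fun_prop)).and ((Sg.of_primrec (by fun_prop)).and ?_)
    exact Sg.graph (p := fun (z : ℕ × ℕ × ℕ) y => Split z.1 (s z.2.1) y) (f := fun z => s z.2.2)
      (Sg.graph (p := fun (z : (ℕ × ℕ × ℕ) × List Bool) y => Split z.1.1 y z.2)
        (f := fun z => s z.1.2.1)
        (.of_primrec (Split.primrec (by fun_prop) (by fun_prop) (by fun_prop)))
        (hs.comp (f := fun w : ((ℕ × ℕ × ℕ) × List Bool) × List Bool => (w.1.1.2.1, w.2))
          (by fun_prop)))
      (hs.comp (f := fun w : (ℕ × ℕ × ℕ) × List Bool => (w.1.2.2, w.2)) (by fun_prop))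
  have hPsymm : ∀ j a b, P (j, a, b) → P (j, b, a) := fun j a b h => ⟨h.2.1, h.1, h.2.2.symm⟩
  have hPanti : ∀ j j' a b, j ≤ j' → P (j', a, b) → P (j, a, b) := fun j j' a b hj h =>
    ⟨hj.trans h.1, hj.trans h.2.1, h.2.2.mono hj⟩
  -- `B` collects the indices whose value is not below that of some partner they split from. Every
  -- split pair contributes one of its members.
  let B : ℕ × ℕ → Prop := fun z => ∃ a, P (z.1, a, z.2) ∧ A (z.2, a)
  have hB : Sg (m + 1) B := Sg.ex (p := fun (z : ℕ × ℕ) a => P (z.1, a, z.2) ∧ A (z.2, a))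
    ((hP.comp (by fun_prop)).and (hA.comp (by fun_prop)))
  have hPB : ∀ j a b, P (j, a, b) → B (j, a) ∨ B (j, b) := fun j a b h => by
    by_cases hab : L.Lt (v b) (v a)
    · exact .inl ⟨b, hPsymm _ _ _ h, hab.asymm⟩
    · exact .inr ⟨a, h, hab⟩
  have hBne : ∀ j, ∃ b, B (j, b) := fun j => by
    rcases hPB j (2 * j) (2 * j + 1) ⟨by dsimp only; omega, by dsimp only; omega, hsplit j⟩
      with h | h
    exacts [⟨_, h⟩, ⟨_, h⟩]
  have hminSg : ∀ {C : ℕ × ℕ → Prop}, Sg (m + 1) C →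
      Sg (m + 2) fun z : ℕ × ℕ => C z ∧ ¬ ∃ b, C (z.1, b) ∧ L.Lt (v b) (v z.2) := fun {C} hC =>
    hC.succ.and (Sg.not (Sg.ex (p := fun (z : ℕ × ℕ) b => C (z.1, b) ∧ L.Lt (v b) (v z.2))
      ((hC.comp (by fun_prop)).and
        (hA'.comp (f := fun w : (ℕ × ℕ) × ℕ => (w.2, w.1.2)) (by fun_prop)))))
  have hminEx : ∀ {C : ℕ × ℕ → Prop}, Sg (m + 1) C → ∀ j, (∃ b, C (j, b)) →
      ∃ b, C (j, b) ∧ ¬ ∃ b', C (j, b') ∧ L.Lt (v b') (v b) := fun {C} hC j hne => by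
    obtain ⟨b, hb, hmin⟩ := ComputableLinearOrder.exists_least hL hv
      (P := fun b => C (j, b)) (hC.comp (by fun_prop)) hne
    exact ⟨b, hb, fun ⟨b', h, h'⟩ => hmin b' h h'⟩
  let M : ℕ × ℕ → Prop := fun z => B z ∧ ¬ ∃ b, B (z.1, b) ∧ L.Lt (v b) (v z.2)
  have hM : Sg (m + 2) M := hminSg hB
  -- If beyond every level some minimal `b` has a partner not below the given minimum `b₀`, such
  -- pairs can be chained. Otherwise there is one `b₀` such that, from some level on, all these
  -- partners lie below it.
  by_cases hcase : ∀ j₀ b₀, M (j₀, b₀) → ∀ J, ∃ j a b, J ≤ j ∧ P (j, a, b) ∧ A (b, a) ∧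
      M (j, b) ∧ A (a, b₀)
  · refine exists_blockAscending_of_step hv.succ hc
      (Ok := fun z => P z ∧ A (z.2.2, z.2.1) ∧ M (z.1, z.2.2)) ?_ ?_ ?_ ?_
    · exact hP.succ.and ((hA.succ.comp (by fun_prop)).and (hM.comp (by fun_prop)))
    · exact fun j a b h => h.1
    · obtain ⟨b, hb, hmin⟩ := hminEx hB 0 (hBne 0)
      obtain ⟨a, ha, hab⟩ := hb
      exact ⟨(0, a, b), ha, hab, ⟨a, ha, hab⟩, hmin⟩
    · rintro j a b ⟨hp, hab, hm⟩ J
      obtain ⟨j', a', b', hJ, h1, h2, h3, h4⟩ := hcase j b hm J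
      have h5 := ComputableLinearOrder.not_Lt_trans (hc b) h4 hab
      exact ⟨j', a', b', ⟨h1, h2, h3⟩, hJ, h5,
        ComputableLinearOrder.not_Lt_trans (hc a') h2 h5, h4,
        ComputableLinearOrder.not_Lt_trans (hc a') h2 h4⟩
  · push Not at hcase
    obtain ⟨j₀, b₀, hM₀, J, hJ⟩ := hcase
    let C : ℕ → Prop := fun a => j₀ ≤ a ∧ L.Lt (v a) (v b₀)
    have hC : Sg (m + 1) C :=
      (Sg.of_primrec (by fun_prop)).and (hA'.comp (f := fun a => (a, b₀)) (by fun_prop))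
    -- If two members split, one of them would be in `B` at level `j₀` with a value below the
    -- minimum `b₀`.
    have hCns : ∀ a a', C a → C a' → ¬ Split j₀ (s a) (s a') := by
      intro a a' ha ha' hs
      rcases hPB j₀ a a' ⟨ha.1, ha'.1, hs⟩ with h | h
      · exact hM₀.2 ⟨a, h, ha.2⟩
      · exact hM₀.2 ⟨a', h, ha'.2⟩
    have hD : ∀ j, ∃ a, C a ∧ ∃ b, P (j, a, b) := by
      intro j
      let j' := max j (max J j₀)
      obtain ⟨b, ⟨a, hab, hab'⟩, hmin⟩ := hminEx hB j' (hBne j')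
      have := hJ j' a b (by simp [j']) hab hab' ⟨⟨a, hab, hab'⟩, hmin⟩
      refine ⟨a, ⟨le_trans (by simp [j']) hab.1, not_not.1 this⟩, b,
        hPanti _ _ _ _ (le_max_left _ _) hab⟩
    -- Pigeonhole: there are finitely many strings of length `j₀`, so one of them begins members of
    -- `C` with partners splitting at unboundedly high levels.
    obtain ⟨τ, hτ⟩ : ∃ τ : List Bool, ∀ j, ∃ a, C a ∧ (s a).take j₀ = τ ∧ ∃ b, P (j, a, b) := by
      by_contra! hcon
      choose N hN using hcon
      obtain ⟨K, hK⟩ := ((List.finite_length_eq Bool j₀).image N).bddAbove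
      obtain ⟨a, ha, b, hab⟩ := hD (max j₀ K)
      have hlen := hab.2.2.lt_length
      dsimp only at hlen
      have hKτ : N ((s a).take j₀) ≤ K := hK ⟨_, by
        simp only [Set.mem_ofPred_eq, List.length_take]; omega, rfl⟩
      exact hN _ a ha rfl b (hPanti _ _ _ _ (by omega) hab)
    have hY : Sg (m + 1) fun z : ℕ × Bool =>
        ∃ a, C a ∧ ∃ σ, s a = σ ∧ σ.take j₀ = τ ∧ σ[z.1]? = some z.2 := by
      refine Sg.ex (p := fun (z : ℕ × Bool) a => C a ∧ ∃ σ, s a = σ ∧ σ.take j₀ = τ ∧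
        σ[z.1]? = some z.2) ((hC.comp (by fun_prop)).and ?_)
      exact Sg.ex (p := fun (z : (ℕ × Bool) × ℕ) σ => s z.2 = σ ∧ σ.take j₀ = τ ∧
        σ[z.1.1]? = some z.1.2) ((hs.comp (f := fun w : ((ℕ × Bool) × ℕ) × List Bool =>
          (w.1.2, w.2)) (by fun_prop)).and (.of_primrec (by fun_prop)))
    -- The strings of members of `C` through `τ` are pairwise compatible and arbitrarily long; their
    -- union `y` has a graph of class `m + 1`.
    obtain ⟨y, hy, hyg⟩ := Sg.choice
      (P := fun i c => ∃ a, C a ∧ ∃ σ, s a = σ ∧ σ.take j₀ = τ ∧ σ[i]? = some c) hY (by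
        intro i
        obtain ⟨a, ha, hτa, b, hab⟩ := hτ i
        have hlen := hab.2.2.lt_length
        exact ⟨(s a)[i], a, ha, _, rfl, hτa, List.getElem?_eq_getElem hlen⟩)
    have hagree : ∀ a, C a → (s a).take j₀ = τ → ∀ i < (s a).length, (s a)[i]? = some (y i) := by
      intro a ha hτa i hi
      obtain ⟨a', ha', _, rfl, hτa', hi'⟩ := hy i
      rw [← hi']
      by_contra hne
      exact hCns a a' ha ha' (Split.of_ne (hτa.trans hτa'.symm) hi
        (List.getElem?_eq_some_iff.1 hi').1 hne)
    -- `E` contains the indices whose string first leaves `y` at the given level or later. It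
    -- shrinks as the level rises, so the minima of `v` on it never descend.
    let E : ℕ × ℕ → Prop := fun z => z.1 ≤ z.2 ∧ ∃ i < (s z.2).length, z.1 ≤ i ∧
      (s z.2).take i = initSeg y i ∧ (s z.2)[i]? ≠ some (y i)
    have hEiff : ∀ z, E z ↔ z.1 ≤ z.2 ∧ ∃ σ, s z.2 = σ ∧ ∃ l : List Bool,
        (∀ i < l.length, y i = l.getD i false) ∧ Split z.1 σ l := by
      intro z
      refine and_congr_right fun _ => ?_
      constructor
      · rintro ⟨i, hi, hz, h1, h2⟩
        refine ⟨_, rfl, initSeg y (i + 1), ?_, i, hi, hz, by simp, ?_, ?_⟩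
        · intro k hk
          rw [length_initSeg] at hk
          rw [getD_initSeg, if_pos hk]
        · rw [h1, take_initSeg y (by omega)]
        · rwa [getElem?_initSeg, if_pos (by omega)]
      · rintro ⟨_, rfl, l, hl, i, hi, hz, hil, h1, h2⟩
        have hl' : l = initSeg y l.length := by
          apply List.ext_getElem?
          intro k
          rw [getElem?_initSeg]
          split_ifs with hk
          · rw [hl k hk]
            simp [List.getD, hk]
          · simpa using hk
        rw [hl', take_initSeg y (by omega)] at h1
        rw [hl', getElem?_initSeg, if_pos hil] at h2
        exact ⟨i, hi, hz, h1, h2⟩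
    have hE : Sg (m + 1) E := by
      refine Sg.of_eq ?_ fun z => (hEiff z).symm
      refine (Sg.of_primrec (by fun_prop)).and ?_
      refine Sg.ex (p := fun (z : ℕ × ℕ) σ => s z.2 = σ ∧ ∃ l : List Bool,
        (∀ i < l.length, y i = l.getD i false) ∧ Split z.1 σ l) (.and
        (hs.comp (f := fun w : (ℕ × ℕ) × List Bool => (w.1.2, w.2)) (by fun_prop)) ?_)
      refine Sg.ex (p := fun (z : (ℕ × ℕ) × List Bool) l =>
        (∀ i < l.length, y i = l.getD i false) ∧ Split z.1.1 z.2 l) (.and ?_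
        (.of_primrec (Split.primrec (by fun_prop) (by fun_prop) (by fun_prop))))
      exact Sg.ball (p := fun (w : ((ℕ × ℕ) × List Bool) × List Bool) i => y i = w.2.getD i false)
        (b := fun w => w.2.length) (by fun_prop) (hyg.comp (f := fun w :
          (((ℕ × ℕ) × List Bool) × List Bool) × ℕ => (w.2, w.1.2.getD w.2 false)) (by fun_prop))
    have hEanti : ∀ j j' b, j ≤ j' → E (j', b) → E (j, b) := by
      rintro j j' b hj ⟨h1, i, h2, h3, h4⟩
      exact ⟨hj.trans h1, i, h2, hj.trans h3, h4⟩
    have hEne : ∀ j, ∃ b, E (j, b) := by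
      intro j
      -- The string of `a` lies on `y`, so its partner `b` leaves `y` where the two split.
      obtain ⟨a, ha, hτa, b, -, hjb, i, hi, hji, hib, htake, hne⟩ := hτ j
      refine ⟨b, hjb, i, hib, hji, ?_, ?_⟩
      · dsimp only
        rw [← htake]
        apply List.ext_getElem?
        intro k
        rw [List.getElem?_take, getElem?_initSeg]
        split_ifs with hk
        · exact hagree a ha hτa k (by dsimp only at hi; omega)
        · rfl
      · rw [← hagree a ha hτa i hi]
        exact hne.symm
    let M' : ℕ × ℕ → Prop := fun z => E z ∧ ¬ ∃ b, E (z.1, b) ∧ L.Lt (v b) (v z.2)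
    have hM' : Sg (m + 2) M' := hminSg hE
    have hM'le : ∀ j j' b b', j ≤ j' → M' (j, b) → M' (j', b') → A (b', b) :=
      fun j j' b b' hj h h' hlt => h.2 ⟨b', hEanti _ _ _ hj h'.1, hlt⟩
    -- The second member is minimal at a level not below the length of the first string, so it still
    -- follows `y` where the first one leaves it, and the two split there.
    refine exists_blockAscending_of_step hv.succ hc
      (Ok := fun z => M' (z.1, z.2.1) ∧ ∃ j', M' (j', z.2.2) ∧ z.1 ≤ j' ∧
        ∃ σ, s z.2.1 = σ ∧ σ.length ≤ j') ?_ ?_ ?_ ?_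
    · refine (hM'.comp (by fun_prop)).and ?_
      refine Sg.ex (p := fun (z : ℕ × ℕ × ℕ) j' => M' (j', z.2.2) ∧ z.1 ≤ j' ∧
        ∃ σ, s z.2.1 = σ ∧ σ.length ≤ j') ((hM'.comp (by fun_prop)).and
        ((Sg.of_primrec (by fun_prop)).and ?_))
      exact Sg.ex (p := fun (z : (ℕ × ℕ × ℕ) × ℕ) σ => s z.1.2.1 = σ ∧ σ.length ≤ z.2)
        ((hs.succ.comp (f := fun w : ((ℕ × ℕ × ℕ) × ℕ) × List Bool => (w.1.1.2.1, w.2))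
          (by fun_prop)).and (.of_primrec (by fun_prop)))
    · rintro j a b ⟨ha, j', hb, hjj', _, rfl, hlen⟩
      obtain ⟨⟨hja, i, hi, hji, hta, hne⟩, -⟩ := ha
      obtain ⟨⟨hjb, i', hi', hji', htb, -⟩, -⟩ := hb
      dsimp only at hja hi hji hta hne hjb hi' hji' htb hjj' hlen
      have hb' : ∀ k < i', (s b)[k]? = some (y k) := fun k hk => by
        have := congrArg (fun l => l[k]?) htb
        simp only [List.getElem?_take, getElem?_initSeg, hk, if_true] at this
        exact this
      refine ⟨hja, hjj'.trans hjb, i, hi, hji, by omega, ?_, ?_⟩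
      · rw [hta, ← take_initSeg y (show i ≤ i' by omega), ← htb, List.take_take,
          min_eq_left (by omega)]
      · rw [hb' i (by omega)]
        exact hne
    · obtain ⟨a, ha⟩ := hminEx hE 0 (hEne 0)
      obtain ⟨b, hb⟩ := hminEx hE (s a).length (hEne _)
      exact ⟨(0, a, b), ha, _, hb, Nat.zero_le _, _, rfl, le_rfl⟩
    · rintro j a b ⟨ha, j', hb, hjj', -⟩ J'
      let k := max J' j'
      have hk : j' ≤ k := le_max_right _ _
      dsimp only at hjj'
      obtain ⟨a', ha'⟩ := hminEx hE k (hEne k)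
      obtain ⟨b', hb'⟩ := hminEx hE (max k (s a').length) (hEne _)
      exact ⟨k, a', b', ⟨ha', _, hb', le_max_left _ _, _, rfl, le_max_right _ _⟩, le_max_left _ _,
        hM'le _ _ _ _ (hjj'.trans hk) ha ha',
        hM'le _ _ _ _ ((hjj'.trans hk).trans (le_max_left _ _)) ha hb',
        hM'le _ _ _ _ hk hb ha', hM'le _ _ _ _ (hk.trans (le_max_left _ _)) hb hb'⟩

end Blocks

/-! ### Iterating the thinning over several orders -/

/-- There is a descending sequence whose graph is of class `k`. -/
def ComputableLinearOrder.HasDescending (L : ComputableLinearOrder) (k : ℕ) : Prop :=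
  ∃ f, L.IsDescending f ∧ Sg k fun z : ℕ × ℕ => f z.1 = z.2

/-- Iteration of `exists_blockAscending` over finitely many orders, such that fewer than `k` of
them have descending sequences of class `r + k + 1`. -/
theorem exists_ascending_family {ι W : Type} [DecidableEq ι] [Primcodable W]
    (L : ι → ComputableLinearOrder) {str : W → List Bool} (hstr : Primrec str) {c : ι → W → ℕ}
    (hc : ∀ i, Primrec (c i)) {T : W → Prop} {r : ℕ} {e₀ : ℕ → W} (hT : ∀ x, T (e₀ x))
    (he : Sg (r + 2) fun z : ℕ × W => e₀ z.1 = z.2)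
    (hsplit : ∀ t, Split t (str (e₀ (2 * t))) (str (e₀ (2 * t + 1)))) (Q : Finset ι)
    (hTc : ∀ w, T w → ∀ i ∈ Q, c i w ∈ (L i).carrier)
    (hQ : ∀ k, 1 ≤ k → k ≤ Q.card → ∀ Q' ⊆ Q, (∀ i ∈ Q', (L i).HasDescending (r + k + 1)) →
      Q'.card < k) :
    ∃ e : ℕ → W, (∀ x, T (e x)) ∧ (Sg (r + 2 + Q.card) fun z : ℕ × W => e z.1 = z.2) ∧
      (∀ t, Split t (str (e (2 * t))) (str (e (2 * t + 1)))) ∧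
      ∀ i ∈ Q, ∀ x y, x / 2 < y / 2 → ¬ (L i).Lt (c i (e y)) (c i (e x)) := by
  classical
  induction hq : Q.card generalizing Q with
  | zero =>
    obtain rfl := Finset.card_eq_zero.1 hq
    exact ⟨e₀, hT, he, hsplit, by simp⟩
  | succ q ih =>
    -- An order of `Q` without descending sequences of class `r + q + 2` is treated last: after the
    -- other `q` orders the sequence of blocks has exactly this class.
    obtain ⟨i, hi, hlow⟩ : ∃ i ∈ Q, ¬ (L i).HasDescending (r + (q + 1) + 1) := by
      by_contra! hcon
      exact (hQ (q + 1) (by omega) hq.ge Q le_rfl hcon).ne hq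
    have hcard : (Q.erase i).card = q := by rw [Finset.card_erase_of_mem hi, hq]; rfl
    obtain ⟨e, heT, heg, hes, hea⟩ := ih (Q.erase i)
      (fun w hw j hj => hTc w hw j (Finset.mem_of_mem_erase hj))
      (fun k h1 hk Q' hQ' => hQ k h1 (by omega) Q' (hQ'.trans (Finset.erase_subset _ _))) hcard
    have hg : ∀ {β : Type} [Primcodable β] {f : W → β}, Primrec f →
        Sg (r + (q + 1) + 1) fun z : ℕ × β => f (e z.1) = z.2 := fun {β} _ {f} hf =>
      Sg.graph (p := fun (z : ℕ × β) w => f w = z.2) (f := fun z => e z.1)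
        (.of_primrec (by fun_prop))
        ((heg.mono (by omega)).comp (f := fun w : (ℕ × β) × W => (w.1.1, w.2)) (by fun_prop))
    obtain ⟨g, hgg, hg1, hg2, hg3⟩ := exists_blockAscending
      (s := fun x => str (e x)) (v := fun x => c i (e x)) hlow (hg hstr) (hg (hc i))
      (fun x => hTc _ (heT x) i hi) hes
    refine ⟨fun x => e (g x), fun x => heT _, ?_, hg2, ?_⟩
    · refine (Sg.graph (n := r + q + 2) (p := fun (z : ℕ × W) y => e y = z.2)
        (f := fun z => g z.1) ((heg.mono (by omega)).comp (f := fun w : (ℕ × W) × ℕ => (w.2, w.1.2))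
        (by fun_prop)) ((hgg.mono (by omega)).comp (f := fun w : (ℕ × W) × ℕ => (w.1.1, w.2))
        (by fun_prop))).mono (by omega)
    · intro j hj x y hxy
      by_cases hji : j = i
      · subst hji
        exact hg3 x y hxy
      -- The thinning respects the order of blocks, so ascent already achieved survives.
      · exact hea j (Finset.mem_erase.2 ⟨hji, hj⟩) _ _ (hg1 x y hxy)

/-! ### Complexity of joins and of sets computed from them -/

theorem seqJoin_eq_iff {n : ℕ} {f : Fin n → ℕ → ℕ} {j z : ℕ} :
    seqJoin f j = z ↔
      (∀ i : Fin n, j.unpair.1 = i → f i j.unpair.2 = z) ∧ (n ≤ j.unpair.1 → z = 0) := by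
  unfold seqJoin
  split_ifs with h
  · constructor
    · intro hz
      refine ⟨fun i hi => ?_, fun hn => absurd h (by omega)⟩
      rw [← hz]
      congr 1
      exact Fin.ext hi.symm
    · exact fun hz => hz.1 ⟨_, h⟩ rfl
  · exact ⟨fun hz => ⟨fun i hi => absurd i.2 (by omega), fun _ => hz.symm⟩,
      fun hz => (hz.2 (by omega)).symm⟩

theorem Sg.forall_fintype {α ι : Type} [Primcodable α] [Fintype ι] {m : ℕ} {p : ι → α → Prop}
    (h : ∀ i, Sg m (p i)) : Sg m fun x => ∀ i, p i x := by
  classical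
  have : ∀ Q : Finset ι, Sg m fun x => ∀ i ∈ Q, p i x := by
    intro Q
    induction Q using Finset.induction_on with
    | empty => exact (Sg.of_primrec (.const True)).of_eq fun x => by simp
    | insert i Q _ ih => exact ((h i).and ih).of_eq fun x => by simp
  exact (this Finset.univ).of_eq fun x => by simp

theorem Sg.imp_const {α : Type} [Primcodable α] {m : ℕ} {q : Prop} {p : α → Prop}
    (h : q → Sg m p) : Sg m fun x => q → p x := by
  by_cases hq : q
  · exact (h hq).of_eq fun x => by simp [hq]
  · exact (Sg.of_primrec (.const True)).of_eq fun x => by simp [hq]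

theorem Sg.imp_primrec {α : Type} [Primcodable α] {m : ℕ} {p q : α → Prop} (hq : PrimrecPred q)
    (h : Sg m p) : Sg m fun x => q x → p x :=
  ((Sg.of_primrec hq.not).or h).of_eq fun x => by tauto

/-- The entry of row `i` in column `k` of a list of columns. -/
def entry {n : ℕ} (τ : List (Fin n → ℕ)) (k : ℕ) (i : Fin n) : ℕ := τ.getD k 0 i

@[fun_prop] theorem primrec_entry {α : Type} [Primcodable α] {n : ℕ} {f : α → List (Fin n → ℕ)}
    {g : α → ℕ} (hf : Primrec f) (hg : Primrec g) (i : Fin n) :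
    Primrec fun x => entry (f x) (g x) i :=
  Primrec.fin_app.comp (show Primrec fun x => (f x).getD (g x) 0 by fun_prop) (Primrec.const i)

theorem entry_initSeg {n : ℕ} (G : ℕ → Fin n → ℕ) {N k : ℕ} (h : k < N) (i : Fin n) :
    entry (initSeg G N) k i = G k i := by
  rw [entry, getD_initSeg, if_pos h]

theorem entry_append {n : ℕ} {τ : List (Fin n → ℕ)} (c : Fin n → ℕ) {k : ℕ} (h : k < τ.length)
    (i : Fin n) : entry (τ ++ [c]) k i = entry τ k i := by
  simp [entry, List.getD, List.getElem?_append_left h]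

theorem entry_append_length {n : ℕ} (τ : List (Fin n → ℕ)) (c : Fin n → ℕ) (i : Fin n) :
    entry (τ ++ [c]) τ.length i = c i := by
  simp [entry, List.getD]

/-- A join of functions with graphs in a class has its graph in that class. -/
theorem Sg.seqJoin {n m : ℕ} {α : Type} [Primcodable α] {f : α → Fin n → ℕ → ℕ}
    (hf : ∀ i, Sg m fun z : α × ℕ × ℕ => f z.1 i z.2.1 = z.2.2) :
    Sg m fun z : α × ℕ × ℕ => seqJoin (f z.1) z.2.1 = z.2.2 := by
  refine Sg.of_eq ?_ fun z => seqJoin_eq_iff.symm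
  refine (Sg.forall_fintype fun i => Sg.imp_primrec (by fun_prop) ?_).and
    (Sg.of_primrec (.imp (by fun_prop) (by fun_prop)))
  exact (hf i).comp (f := fun z : α × ℕ × ℕ => (z.1, z.2.1.unpair.2, z.2.2)) (by fun_prop)

theorem isDeltaZero_succ_iff {n : ℕ} {X : Set ℕ} :
    IsDeltaZero (n + 1) X ↔ (Sg (n + 1) fun x => x ∈ X) ∧ Sg (n + 1) fun x => x ∉ X :=
  and_congr isSigmaZero_succ_iff_sg isSigmaZero_succ_iff_sg

/-- A set which is Turing reducible to a function with a `Δ` graph is `Δ`. -/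
theorem SetTuringReducible.isDeltaZero {n : ℕ} {X : Set ℕ} {F : ℕ → ℕ}
    (h : SetTuringReducible X F) (hF : Sg (n + 1) fun z : ℕ × ℕ => F z.1 = z.2) :
    IsDeltaZero (n + 1) X := by
  obtain ⟨Φ, hΦ, H⟩ := setTuringReducible_iff.1 h
  have key : ∀ c : ℕ, Sg (n + 1) fun x => charFun X x = c := by
    intro c
    have h1 : Sg (n + 1) fun x : ℕ => ∃ l : List ℕ, (∀ j < l.length, F j = l.getD j 0) ∧
        Φ (l, (x, c)) := by
      refine Sg.ex (p := fun (x : ℕ) (l : List ℕ) => (∀ j < l.length, F j = l.getD j 0) ∧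
        Φ (l, (x, c))) (.and ?_ ((hΦ.mono (by omega)).comp (by fun_prop)))
      exact Sg.ball (p := fun (w : ℕ × List ℕ) j => F j = w.2.getD j 0)
        (b := fun w => w.2.length) (by fun_prop)
        (hF.comp (f := fun w : (ℕ × List ℕ) × ℕ => (w.2, w.1.2.getD w.2 0)) (by fun_prop))
    refine h1.of_eq fun x => ?_
    rw [show charFun X x = c ↔ ∃ k, Φ (initSeg F k, (x, c)) from H (x, c)]
    constructor
    · rintro ⟨l, hl, h⟩
      refine ⟨l.length, ?_⟩
      have : initSeg F l.length = l := by
        apply List.ext_getElem?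
        intro k
        rw [getElem?_initSeg]
        split_ifs with hk
        · rw [hl k hk]
          simp [List.getD, hk]
        · simpa using hk
      rwa [this]
    · rintro ⟨k, hk⟩
      refine ⟨_, fun j hj => ?_, hk⟩
      rw [length_initSeg] at hj
      rw [getD_initSeg, if_pos hj]
  rw [isDeltaZero_succ_iff]
  refine ⟨(key 1).of_eq fun x => ?_, (key 0).of_eq fun x => ?_⟩ <;>
  · unfold charFun
    split_ifs with h <;> simp [h]

/-! ### The ill-founded part of an order -/

namespace ComputableLinearOrder

variable {L : ComputableLinearOrder}

/-- The element `a` is the first term of a descending sequence. -/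
def IllAt (L : ComputableLinearOrder) (a : ℕ) : Prop := ∃ f, f 0 = a ∧ L.IsDescending f

theorem IllAt.of_lt {a b : ℕ} (h : L.IllAt a) (hab : L.Lt a b) : L.IllAt b := by
  obtain ⟨f, rfl, hf⟩ := h
  refine ⟨fun k => Nat.casesOn k b f, rfl, isDescending_iff.2 fun k => ?_⟩
  cases k with
  | zero => exact hab
  | succ k => exact isDescending_iff.1 hf k

/-- The ill-founded part is a final segment. This gives the forcing a substitute for goodness:
comparing last entries with those of a good condition. -/
theorem IllAt.of_not_lt {a b : ℕ} (h : L.IllAt a) (hb : b ∈ L.carrier) (hab : ¬ L.Lt b a) :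
    L.IllAt b := by
  by_cases e : a = b
  · exact e ▸ h
  · obtain ⟨f, rfl, hf⟩ := h
    rcases L.lt_total _ (hf 0).1 b hb e with h' | h'
    · exact IllAt.of_lt ⟨f, rfl, hf⟩ ⟨(hf 0).1, hb, h'⟩
    · exact absurd ⟨hb, (hf 0).1, h'⟩ hab

theorem IllAt.exists_lt {a : ℕ} (h : L.IllAt a) : ∃ b, L.IllAt b ∧ L.Lt b a := by
  obtain ⟨f, rfl, hf⟩ := h
  exact ⟨f 1, ⟨fun k => f (k + 1), rfl, fun k => hf (k + 1)⟩, isDescending_iff.1 hf 0⟩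

theorem IsDescending.illAt {f : ℕ → ℕ} (hf : L.IsDescending f) (k : ℕ) : L.IllAt (f k) :=
  ⟨fun j => f (k + j), rfl, fun j => hf (k + j)⟩

theorem IllFounded.exists_isDescending (h : L.IllFounded) : ∃ f, L.IsDescending f := by
  unfold IllFounded at h
  rw [wellFounded_iff_isEmpty_descending_chain, not_isEmpty_iff] at h
  obtain ⟨f, hf⟩ := h
  exact ⟨fun k => f k, fun k => ⟨(f k).2, hf k⟩⟩

theorem IsDescending.illFounded {f : ℕ → ℕ} (hf : L.IsDescending f) : L.IllFounded := by
  unfold IllFounded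
  rw [wellFounded_iff_isEmpty_descending_chain, not_isEmpty_iff]
  exact ⟨fun k => ⟨f k, (hf k).1⟩, fun k => (hf k).2⟩

end ComputableLinearOrder

/-! ### Forcing with finite descending tuples -/

section Forcing

variable {n : ℕ} (L : Fin n → ComputableLinearOrder) (S : Finset (Fin n)) (f : Fin n → ℕ → ℕ)

/-- The list of columns `τ` is a finite part of a tuple of descending sequences, of which those in
`S` are the prescribed ones. -/
def FinDesc (τ : List (Fin n → ℕ)) : Prop :=
  ∀ k < τ.length, ∀ i, entry τ k i ∈ (L i).carrier ∧ (i ∈ S → f i k = entry τ k i) ∧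
    (k + 1 < τ.length → (L i).Lt (entry τ (k + 1) i) (entry τ k i))

/-- The last entry in row `i`. -/
def lastEntry (i : Fin n) (τ : List (Fin n → ℕ)) : ℕ := entry τ (τ.length - 1) i

/-- A finite part of a tuple of descending sequences which can be continued. -/
def GoodDesc (τ : List (Fin n → ℕ)) : Prop :=
  FinDesc L S f τ ∧ 0 < τ.length ∧ ∀ i, (L i).IllAt (lastEntry i τ)

variable {L S f}

theorem primrec_lastEntry (i : Fin n) : Primrec (lastEntry i) := by
  unfold lastEntry
  fun_prop

theorem sg_finDesc {m : ℕ} (hf : ∀ i ∈ S, Sg (m + 1) fun z : ℕ × ℕ => f i z.1 = z.2) :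
    Sg (m + 1) (FinDesc L S f) := by
  refine Sg.ball (p := fun (τ : List (Fin n → ℕ)) k => ∀ i, entry τ k i ∈ (L i).carrier ∧
    (i ∈ S → f i k = entry τ k i) ∧
    (k + 1 < τ.length → (L i).Lt (entry τ (k + 1) i) (entry τ k i)))
    (b := fun τ => τ.length) (by fun_prop) (Sg.forall_fintype fun i => ?_)
  refine .and ?_ (.and (Sg.imp_const fun hi => ?_) (Sg.imp_primrec (by fun_prop) ?_))
  · exact ((L i).carrier_computable.sg.mono (by omega)).comp
      (f := fun z : List (Fin n → ℕ) × ℕ => entry z.1 z.2 i) (by fun_prop)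
  · exact (hf i hi).comp (f := fun z : List (Fin n → ℕ) × ℕ => (z.2, entry z.1 z.2 i))
      (by fun_prop)
  · exact (L i).sg_Lt.comp
      (f := fun z : List (Fin n → ℕ) × ℕ => (entry z.1 (z.2 + 1) i, entry z.1 z.2 i))
      (by fun_prop)

theorem exists_goodDesc (hL : ∀ i, (L i).IllFounded) (hf : ∀ i ∈ S, (L i).IsDescending (f i)) :
    ∃ τ, GoodDesc L S f τ := by
  classical
  have : ∀ i, ∃ a, (L i).IllAt a ∧ (i ∈ S → f i 0 = a) := by
    intro i
    by_cases hi : i ∈ S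
    · exact ⟨_, (hf i hi).illAt 0, fun _ => rfl⟩
    · obtain ⟨g, hg⟩ := (hL i).exists_isDescending
      exact ⟨_, hg.illAt 0, fun h => absurd h hi⟩
  choose c hc hcf using this
  refine ⟨[c], fun k hk i => ?_, by simp, fun i => hc i⟩
  obtain rfl : k = 0 := by simpa using hk
  obtain ⟨g, hg, hg'⟩ := hc i
  refine ⟨?_, hcf i, by simp⟩
  have := (hg' 0).1
  rw [hg] at this
  exact this

theorem GoodDesc.exists_extension (hf : ∀ i ∈ S, (L i).IsDescending (f i))
    {τ : List (Fin n → ℕ)} (h : GoodDesc L S f τ) :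
    ∃ c, GoodDesc L S f (τ ++ [c]) := by
  classical
  obtain ⟨h1, h2, h3⟩ := h
  have : ∀ i, ∃ a, (L i).IllAt a ∧ (i ∈ S → f i τ.length = a) ∧ (L i).Lt a (lastEntry i τ) := by
    intro i
    by_cases hi : i ∈ S
    · refine ⟨_, (hf i hi).illAt τ.length, fun _ => rfl, ?_⟩
      have := (h1 (τ.length - 1) (by omega) i).2.1 hi
      rw [lastEntry, ← this]
      have h4 := ComputableLinearOrder.isDescending_iff.1 (hf i hi) (τ.length - 1)
      rwa [Nat.sub_add_cancel h2] at h4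
    · obtain ⟨a, ha, hlt⟩ := (h3 i).exists_lt
      exact ⟨a, ha, fun h => absurd h hi, hlt⟩
  choose c hc hcf hlt using this
  refine ⟨c, fun k hk i => ?_, by simp, fun i => ?_⟩
  · rw [List.length_append, List.length_singleton] at hk ⊢
    rcases (show k < τ.length ∨ k = τ.length by omega) with hk' | rfl
    · rw [entry_append c hk']
      refine ⟨(h1 k hk' i).1, (h1 k hk' i).2.1, fun _ => ?_⟩
      rcases (show k + 1 < τ.length ∨ k + 1 = τ.length by omega) with hk2 | hk2
      · rw [entry_append c hk2]
        exact (h1 k hk' i).2.2 hk2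
      · rw [hk2, entry_append_length]
        have := hlt i
        rwa [lastEntry, ← hk2, Nat.add_sub_cancel] at this
    · rw [entry_append_length]
      exact ⟨(hlt i).1, hcf i, fun h => by omega⟩
  · have := hc i
    rw [lastEntry, List.length_append, List.length_singleton, Nat.add_sub_cancel,
      entry_append_length]
    exact this

/-- All positions of the list `l` are determined by the columns `τ`, with the values which the
join of the rows has there. -/
def Covers (τ : List (Fin n → ℕ)) (l : List ℕ) : Prop :=
  ∀ j < l.length, (j.unpair.1 < n → j.unpair.2 < τ.length) ∧
    seqJoin (fun i k => entry τ k i) j = l.getD j 0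

theorem sg_covers {m : ℕ} :
    Sg m fun z : List (Fin n → ℕ) × List ℕ => Covers z.1 z.2 := by
  refine Sg.ball (p := fun (z : List (Fin n → ℕ) × List ℕ) j =>
    (j.unpair.1 < n → j.unpair.2 < z.1.length) ∧
    seqJoin (fun i k => entry z.1 k i) j = z.2.getD j 0) (b := fun z => z.2.length) (by fun_prop)
    (.and (.of_primrec (.imp (by fun_prop) (by fun_prop))) ?_)
  refine (Sg.seqJoin (f := fun (τ : List (Fin n → ℕ)) i k => entry τ k i) fun i =>
    .of_primrec (by fun_prop)).comp
    (f := fun w : (List (Fin n → ℕ) × List ℕ) × ℕ => (w.1.1, w.2, w.1.2.getD w.2 0)) (by fun_prop)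

theorem Covers.eq_initSeg {τ : List (Fin n → ℕ)} {l : List ℕ} (h : Covers τ l)
    {G : ℕ → Fin n → ℕ} (hG : initSeg G τ.length = τ) :
    initSeg (seqJoin fun i k => G k i) l.length = l := by
  apply List.ext_getElem?
  intro j
  rw [getElem?_initSeg]
  split_ifs with hj
  · obtain ⟨h1, h2⟩ := h j hj
    have : seqJoin (fun i k => G k i) j = l.getD j 0 := by
      rw [← h2]
      unfold seqJoin
      split_ifs with hn
      · dsimp only
        rw [← hG, entry_initSeg G (by simpa using h1 hn)]
      · rfl
    rw [this]
    simp [List.getD, hj]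
  · simpa using hj

theorem covers_initSeg (G : ℕ → Fin n → ℕ) {k N : ℕ} (h : k ≤ N) :
    Covers (initSeg G N) (initSeg (seqJoin fun i k => G k i) k) := by
  intro j hj
  rw [length_initSeg] at hj ⊢
  have hlt : j.unpair.2 < N := (Nat.unpair_right_le j).trans_lt (hj.trans_le h)
  refine ⟨fun _ => hlt, ?_⟩
  rw [getD_initSeg, if_pos hj]
  unfold seqJoin
  split_ifs with hn
  · exact entry_initSeg G hlt _
  · rfl

/-- `G` enumerates the columns of a tuple of descending sequences which extends `τ`. -/
def GoodLimit (L : Fin n → ComputableLinearOrder) (S : Finset (Fin n)) (f : Fin n → ℕ → ℕ)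
    (τ : List (Fin n → ℕ)) (G : ℕ → Fin n → ℕ) : Prop :=
  initSeg G τ.length = τ ∧ ∀ M, ∃ N ≥ M, GoodDesc L S f (initSeg G N)

/-- The functional `Φ`, applied to the join of the sequences enumerated by `G`, is not the
characteristic function of `X`. -/
def Diagonal (X : Set ℕ) (Φ : List ℕ × (ℕ × ℕ) → Prop) (G : ℕ → Fin n → ℕ) : Prop :=
  ¬ ∀ z : ℕ × ℕ, charFun X z.1 = z.2 ↔ ∃ k, Φ (initSeg (seqJoin fun i k => G k i) k, z)

end Forcing

section Forcing

variable {n : ℕ} {L : Fin n → ComputableLinearOrder} {S : Finset (Fin n)} {f : Fin n → ℕ → ℕ}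

/-- If every good extension of `σ` had a good limit from which `Φ` computes `X`, then either `X`
would be Δ⁰ at level `S.card + 2`, or stable conditions would split arbitrarily high and the
thinning into ascending blocks would contradict their stability. -/
theorem exists_goodDesc_diagonal (hfd : ∀ i ∈ S, (L i).IsDescending (f i))
    (hf : ∀ i ∈ S, Sg (S.card + 1) fun z : ℕ × ℕ => f i z.1 = z.2)
    (hS : ∀ k, 1 ≤ k → k ≤ Sᶜ.card → ∀ Q' ⊆ Sᶜ,
      (∀ i ∈ Q', (L i).HasDescending (S.card + k + 1)) → Q'.card < k)
    {X : Set ℕ} (hX : ¬ IsDeltaZero (S.card + 2) X)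
    {Φ : List ℕ × (ℕ × ℕ) → Prop} (hΦ : Sg 1 Φ) {σ : List (Fin n → ℕ)} (hσ : GoodDesc L S f σ) :
    ∃ τ, GoodDesc L S f τ ∧ τ.take σ.length = σ ∧
      ∀ G, GoodLimit L S f τ G → Diagonal X Φ G := by
  classical
  by_contra! hcon
  unfold Diagonal at hcon
  simp only [not_not] at hcon
  -- `W` drops ill-foundedness of the last entries: it only asks that `τ` extend `σ` as a finite
  -- descending tuple and give `Φ` enough information to output the string.
  let W : List Bool × List (Fin n → ℕ) → Prop := fun w =>
    (w.2.take σ.length = σ ∧ 0 < w.2.length) ∧ FinDesc L S f w.2 ∧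
    ∀ m < w.1.length, ∃ l, Φ (l, (m, if w.1.getD m false = true then 1 else 0)) ∧ Covers w.2 l
  have hW : Sg (S.card + 1) W := by
    refine .and (.of_primrec (by fun_prop)) (.and ((sg_finDesc hf).comp (by fun_prop)) ?_)
    refine Sg.ball (p := fun (w : List Bool × List (Fin n → ℕ)) m => ∃ l,
      Φ (l, (m, if w.1.getD m false = true then 1 else 0)) ∧ Covers w.2 l)
      (b := fun w => w.1.length) (by fun_prop) ?_
    refine Sg.ex (p := fun (z : (List Bool × List (Fin n → ℕ)) × ℕ) l =>
      Φ (l, (z.2, if z.1.1.getD z.2 false = true then 1 else 0)) ∧ Covers z.1.2 l) (.and ?_ ?_)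
    · exact (hΦ.mono (by omega)).comp (f := fun w : ((List Bool × List (Fin n → ℕ)) × ℕ) × List ℕ =>
        (w.2, (w.1.2, if w.1.1.1.getD w.1.2 false = true then 1 else 0))) (by fun_prop)
    · exact sg_covers.comp (f := fun w : ((List Bool × List (Fin n → ℕ)) × ℕ) × List ℕ =>
        (w.1.1.2, w.2)) (by fun_prop)
  let Xs : ℕ → List Bool := initSeg fun m => decide (m ∈ X)
  have hXs : ∀ m, charFun X m = if decide (m ∈ X) = true then 1 else 0 := fun m => by
    simp [charFun]
  -- On conditions which can be continued, only initial segments of `X` are forced.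
  have hsound : ∀ p τ, W (p, τ) → GoodDesc L S f τ → ∀ m < p.length, p[m]? = (Xs (m + 1))[m]? := by
    rintro p τ ⟨⟨hpre, -⟩, -, hp⟩ hτ m hm
    obtain ⟨G, hG, H⟩ := hcon τ hτ hpre
    obtain ⟨l, hl, hcov⟩ := hp m hm
    have h1 := (H (m, if p.getD m false = true then 1 else 0)).2
      ⟨l.length, by rw [hcov.eq_initSeg hG.1]; exact hl⟩
    simp only [hXs] at h1
    rw [getElem?_initSeg, if_pos (by omega), List.getElem?_eq_getElem hm]
    have h2 : p.getD m false = p[m] := by simp [List.getD, hm]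
    rw [h2] at h1
    congr 1
    cases hpm : p[m] <;> cases hd : decide (m ∈ X) <;> simp_all
  -- A limit above `σ` computes `X`; a long good initial segment of it contains the uses of the
  -- first `M` computations.
  have hcomplete : ∀ M, ∃ τ, GoodDesc L S f τ ∧ W (Xs M, τ) := by
    intro M
    obtain ⟨G, ⟨hG, hGN⟩, H⟩ := hcon σ hσ (by simp)
    have : ∀ m, ∃ k, Φ (initSeg (seqJoin fun i k => G k i) k, (m, charFun X m)) := fun m =>
      (H (m, charFun X m)).1 rfl
    choose k hk using this
    obtain ⟨N, hN, hgood⟩ := hGN (σ.length + (Finset.range M).sup k)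
    refine ⟨_, hgood, ⟨?_, hgood.2.1⟩, hgood.1, fun m hm =>
      ⟨_, ?_, covers_initSeg G (k := k m) ?_⟩⟩
    · dsimp only
      rw [take_initSeg _ (by omega), hG]
    · have h1 : (Xs M).getD m false = decide (m ∈ X) := by
        simp only [Xs, length_initSeg] at hm
        simp only [Xs]
        rw [getD_initSeg, if_pos hm]
      dsimp only
      rw [h1, ← hXs]
      exact hk m
    · simp only [Xs, length_initSeg] at hm
      have := Finset.le_sup (f := k) (Finset.mem_range.2 hm)
      omega
  let Ge : (List Bool × List (Fin n → ℕ)) × (List Bool × List (Fin n → ℕ)) → Prop := fun z =>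
    ∀ i, i ∉ S → ¬ (L i).Lt (lastEntry i z.2.2) (lastEntry i z.1.2)
  have hGe : Sg (S.card + 1) Ge := Sg.forall_fintype fun i => Sg.imp_const fun _ =>
    (L i).sg_not_Lt.comp (f := fun z : (List Bool × List (Fin n → ℕ)) ×
      (List Bool × List (Fin n → ℕ)) => (lastEntry i z.2.2, lastEntry i z.1.2))
      (((primrec_lastEntry i).comp (by fun_prop)).pair ((primrec_lastEntry i).comp (by fun_prop)))
  -- Stability: no member of `W` with last entries at least as large outside `S` gives an
  -- incompatible string. Rows in `S` are prescribed and need no comparison.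
  let T : List Bool × List (Fin n → ℕ) → Prop := fun w =>
    W w ∧ ¬ ∃ w', W w' ∧ Ge (w, w') ∧ Split 0 w.1 w'.1
  have hT : Sg (S.card + 2) T := hW.succ.and (Sg.not (Sg.ex
    (p := fun (w : List Bool × List (Fin n → ℕ)) w' => W w' ∧ Ge (w, w') ∧ Split 0 w.1 w'.1)
    ((hW.comp (by fun_prop)).and ((hGe.comp (by fun_prop)).and
    (.of_primrec (Split.primrec (by fun_prop) (by fun_prop) (by fun_prop)))))))
  have hlast : ∀ τ i, FinDesc L S f τ → 0 < τ.length → lastEntry i τ ∈ (L i).carrier :=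
    fun τ i h h0 => (h (τ.length - 1) (by omega) i).1
  have hgoodT : ∀ p τ, W (p, τ) → GoodDesc L S f τ → T (p, τ) := by
    rintro p τ hw hτ
    refine ⟨hw, ?_⟩
    rintro ⟨⟨p', τ'⟩, hw', hge, i, hi, -, hi', -, hne⟩
    -- Outside `S` the last entries of `τ'` are not below ill-founded ones; in `S` they lie on the
    -- fixed sequences.
    have hgood : GoodDesc L S f τ' := by
      refine ⟨hw'.2.1, hw'.1.2, fun j => ?_⟩
      by_cases hj : j ∈ S
      · have := (hw'.2.1 (τ'.length - 1) (by have := hw'.1.2; dsimp only at *; omega) j).2.1 hj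
        rw [lastEntry, ← this]
        exact (hfd j hj).illAt _
      · exact (hτ.2.2 j).of_not_lt (hlast _ _ hw'.2.1 hw'.1.2) (hge j hj)
    exact hne ((hsound p τ hw hτ i hi).trans (hsound p' τ' hw' hgood i hi').symm)
  have hsplit : ∀ j, ∃ z : (List Bool × List (Fin n → ℕ)) × (List Bool × List (Fin n → ℕ)),
      T z.1 ∧ T z.2 ∧ Split j z.1.1 z.2.1 := by
    by_contra! hj
    obtain ⟨j, hj⟩ := hj
    apply hX
    -- If stable strings never split from level `j` on, those that begin like `X` up to `j` agree
    -- with `X` throughout, which decides `X` at level `S.card + 2`.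
    have key : ∀ b : Bool, Sg (S.card + 2) fun m : ℕ => decide (m ∈ X) = b := by
      intro b
      have h1 : Sg (S.card + 2) fun m : ℕ => ∃ w, T w ∧ w.1.take j = Xs j ∧ w.1[m]? = some b :=
        Sg.ex (p := fun (m : ℕ) w => T w ∧ w.1.take j = Xs j ∧ w.1[m]? = some b)
          ((hT.comp (by fun_prop)).and (.of_primrec (by fun_prop)))
      refine h1.of_eq fun m => ?_
      obtain ⟨τ, hτ, hw⟩ := hcomplete (max j (m + 1))
      have ht := hgoodT _ _ hw hτ
      have htake : (Xs (max j (m + 1))).take j = Xs j := take_initSeg _ (le_max_left _ _)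
      have hm : (Xs (max j (m + 1)))[m]? = some (decide (m ∈ X)) := by
        simp only [Xs]
        rw [getElem?_initSeg, if_pos (by simp)]
      constructor
      · rintro ⟨w, hw', hwj, hwm⟩
        by_contra hne
        refine hj (w, _) hw' ht (Split.of_ne (i := m) (hwj.trans htake.symm)
          (List.getElem?_eq_some_iff.1 hwm).1 (List.getElem?_eq_some_iff.1 hm).1 ?_)
        rw [hwm, hm]
        simpa using fun h => hne h.symm
      · rintro rfl
        exact ⟨_, ht, htake, hm⟩
    rw [isDeltaZero_succ_iff]
    exact ⟨(key true).of_eq fun m => by simp, (key false).of_eq fun m => by simp⟩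
  obtain ⟨h, hh, hhg⟩ := Sg.choice
    (P := fun j (z : (List Bool × List (Fin n → ℕ)) × (List Bool × List (Fin n → ℕ))) =>
      T z.1 ∧ T z.2 ∧ Split j z.1.1 z.2.1)
    ((hT.comp (by fun_prop)).and ((hT.comp (by fun_prop)).and
      (.of_primrec (Split.primrec (by fun_prop) (by fun_prop) (by fun_prop))))) hsplit
  obtain ⟨e₀, he₀, he, ho⟩ := Sg.exists_interleave hhg
  obtain ⟨e, heT, -, hes, hea⟩ := exists_ascending_family L (str := Prod.fst)
    (c := fun i w => lastEntry i w.2) (T := T) (r := S.card) (e₀ := e₀) (by fun_prop)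
    (fun i => (primrec_lastEntry i).comp Primrec.snd)
    (fun x => by
      rcases Nat.even_or_odd' x with ⟨t, rfl | rfl⟩
      · rw [he]; exact (hh t).1
      · rw [ho]; exact (hh t).2.1)
    he₀ (fun t => by rw [he, ho]; exact (hh t).2.2) Sᶜ
    (fun w hw i _ => hlast _ _ hw.1.2.1 hw.1.1.2) hS
  -- Block `0` splits at `i`, while block `i + 1` splits only beyond `i`, so its two strings agree
  -- at `i`. By stability each string of block `0` agrees at `i` with one of them.
  obtain ⟨i, hi0, -, hi1, -, hne⟩ := hes 0
  obtain ⟨i', hi0', hti', hi1', htake, -⟩ := hes (i + 1)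
  have hcompat : ∀ x y, x / 2 < y / 2 → i < (e x).1.length → i < (e y).1.length →
      (e x).1[i]? = (e y).1[i]? := by
    intro x y hxy hx hy
    by_contra hne'
    exact (heT x).2 ⟨e y, (heT y).1, fun j hj => hea j (Finset.mem_compl.2 hj) x y hxy,
      Split.of_ne (i := i) (by simp) hx hy hne'⟩
  apply hne
  have hi2 : i < i' := hti'
  rw [hcompat (2 * 0) (2 * (i + 1)) (by omega) hi0 (hi2.trans hi0'),
    hcompat (2 * 0 + 1) (2 * (i + 1) + 1) (by omega) hi1 (hi2.trans hi1')]
  have := congrArg (fun l => l[i]?) htake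
  simp only [List.getElem?_take, hi2, if_true] at this
  exact this

theorem countable_sg_one : {Φ : List ℕ × (ℕ × ℕ) → Prop | Sg 1 Φ}.Countable := by
  refine (Set.countable_range fun (c : Nat.Partrec.Code) (x : List ℕ × (ℕ × ℕ)) =>
    (c.eval (Encodable.encode x)).Dom).mono ?_
  intro Φ hΦ
  obtain ⟨c, hc⟩ := (Sg.rePred hΦ).exists_code
  exact ⟨c, funext fun x => propext (hc x).symm⟩

/-- The requirements are met one at a time along a chain of good conditions. The union has every
condition of the chain as an initial segment, hence is a good limit of each. -/
theorem GoodDesc.exists_limit (hfd : ∀ i ∈ S, (L i).IsDescending (f i))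
    {σ : List (Fin n → ℕ)} (hσ : GoodDesc L S f σ)
    {ι : Type} [Nonempty ι] [Countable ι] {D : ι → (ℕ → Fin n → ℕ) → Prop}
    (hD : ∀ d σ, GoodDesc L S f σ → ∃ τ, GoodDesc L S f τ ∧ τ.take σ.length = σ ∧
      ∀ G, GoodLimit L S f τ G → D d G) :
    ∃ G : ℕ → Fin n → ℕ, (∀ d, D d G) ∧ ∀ i, (L i).IsDescending fun k => G k i := by
  obtain ⟨en, hen⟩ := exists_surjective_nat ι
  have hstep : ∀ (d : ι) (σ : {σ // GoodDesc L S f σ}), ∃ τ : {τ // GoodDesc L S f τ},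
      τ.1.take σ.1.length = σ.1 ∧ σ.1.length < τ.1.length ∧
      ∀ G, GoodLimit L S f τ.1 G → D d G := by
    rintro d ⟨σ, hσ⟩
    -- A column is appended first, so that the lengths strictly increase even if the requirement
    -- needs no extension.
    obtain ⟨c, hc⟩ := hσ.exists_extension hfd
    obtain ⟨τ, hτ, hpre, H⟩ := hD d _ hc
    refine ⟨⟨τ, hτ⟩, ?_, ?_, H⟩
    · have := congrArg (List.take σ.length) hpre
      simpa [List.take_take] using this
    · have := congrArg List.length hpre
      simp at this
      dsimp only
      omega
  choose nx h1 h2 h3 using hstep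
  let s : ℕ → {σ // GoodDesc L S f σ} := fun k => Nat.rec ⟨σ, hσ⟩ (fun k τ => nx (en k) τ) k
  have hs : ∀ k, s (k + 1) = nx (en k) (s k) := fun k => rfl
  have hlen : ∀ k, k < (s k).1.length := by
    intro k
    induction k with
    | zero => exact (s 0).2.2.1
    | succ k ih =>
      have := h2 (en k) (s k)
      rw [← hs] at this
      omega
  have hpre : ∀ j k, j ≤ k → (s k).1.take (s j).1.length = (s j).1 := by
    intro j k hjk
    induction hjk with
    | refl => simp
    | @step k _ ih =>
      have e1 := h1 (en k) (s k)
      rw [← hs] at e1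
      have hle : (s j).1.length ≤ (s k).1.length := by
        have := congrArg List.length ih
        simp at this
        exact this
      have h4 : (s (k + 1)).1.take (s j).1.length =
          ((s (k + 1)).1.take (s k).1.length).take (s j).1.length := by
        rw [List.take_take, min_eq_left hle]
      exact h4.trans (by rw [e1, ih])
  let G : ℕ → Fin n → ℕ := fun k => (s k).1.getD k 0
  have hG : ∀ k, initSeg G (s k).1.length = (s k).1 := by
    intro k
    apply List.ext_getElem?
    intro j
    rw [getElem?_initSeg]
    split_ifs with hj
    · simp only [G, List.getD]
      have hcomm : (s j).1[j]? = (s k).1[j]? := by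
        rcases le_total j k with h | h
        · have := congrArg (fun l => l[j]?) (hpre j k h)
          simp only [List.getElem?_take, hlen j, if_true] at this
          exact this.symm
        · have := congrArg (fun l => l[j]?) (hpre k j h)
          simp only [List.getElem?_take, hj, if_true] at this
          exact this
      rw [hcomm, List.getElem?_eq_getElem hj]
      rfl
    · simpa using hj
  have hlim : ∀ k, GoodLimit L S f (s k).1 G := fun k =>
    ⟨hG k, fun M => ⟨(s M).1.length, (hlen M).le, by rw [hG]; exact (s M).2⟩⟩
  refine ⟨G, fun d => ?_, fun i => ?_⟩
  · obtain ⟨k, rfl⟩ := hen d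
    exact h3 (en k) (s k) G (hlim (k + 1))
  · rw [ComputableLinearOrder.isDescending_iff]
    intro k
    have hk := hlen (k + 1)
    have := ((s (k + 1)).2.1 k (by omega) i).2.2 hk
    rw [← hG (k + 1), entry_initSeg G hk, entry_initSeg G (by omega)] at this
    exact this

end Forcing

/-! ### Cone avoidance -/

/-- Cone avoidance for tuples of descending sequences. -/
theorem exists_isDescending_not_setTuringReducible {n : ℕ} (L : Fin n → ComputableLinearOrder)
    (hL : ∀ i, (L i).IllFounded) (X : Set ℕ) (hX : ¬ IsDeltaZero (n + 1) X) :
    ∃ f : Fin n → ℕ → ℕ, (∀ i, (L i).IsDescending (f i)) ∧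
      ¬ SetTuringReducible X (seqJoin f) := by
  classical
  obtain ⟨S, hSmem, hSmax⟩ := Finset.exists_max_image
    ((Finset.univ : Finset (Finset (Fin n))).filter
      fun S => ∀ i ∈ S, (L i).HasDescending (S.card + 1)) Finset.card ⟨∅, by simp⟩
  simp only [Finset.mem_filter, Finset.mem_univ, true_and] at hSmem hSmax
  have : ∀ i, ∃ f, i ∈ S → (L i).IsDescending f ∧ Sg (S.card + 1) fun z : ℕ × ℕ => f z.1 = z.2 := by
    intro i
    by_cases hi : i ∈ S
    · obtain ⟨f, hf⟩ := hSmem i hi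
      exact ⟨f, fun _ => hf⟩
    · exact ⟨0, fun h => absurd h hi⟩
  choose f hf using this
  have hle : S.card ≤ n := by simpa using S.card_le_univ
  rcases hle.eq_or_lt with hcard | hlt
  · have hmem : ∀ i, i ∈ S := by
      intro i
      rw [Finset.card_eq_iff_eq_univ S |>.1 (by simpa using hcard)]
      exact Finset.mem_univ i
    refine ⟨f, fun i => (hf i (hmem i)).1, fun hred => hX (hred.isDeltaZero ?_)⟩
    exact (Sg.seqJoin (f := fun (_ : Unit) => f) fun i => by
      have := (hf i (hmem i)).2
      rw [hcard] at this
      exact this.comp (f := fun z : Unit × ℕ × ℕ => (z.2.1, z.2.2)) (by fun_prop)).comp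
      (f := fun z : ℕ × ℕ => ((), z.1, z.2)) (by fun_prop)
  · have hX' : ¬ IsDeltaZero (S.card + 2) X := fun h => by
      rw [isDeltaZero_succ_iff] at h
      exact hX (isDeltaZero_succ_iff.2 ⟨h.1.mono (by omega), h.2.mono (by omega)⟩)
    -- Otherwise `k` further indices could be added to `S`, since the level allowed to the union is
    -- exactly `S.card + k + 1`.
    have hS : ∀ k, 1 ≤ k → k ≤ Sᶜ.card → ∀ Q' ⊆ Sᶜ,
        (∀ i ∈ Q', (L i).HasDescending (S.card + k + 1)) → Q'.card < k := by
      intro k hk _ Q' hQ' hlow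
      by_contra! hge
      obtain ⟨Q, hQ, rfl⟩ := Finset.exists_subset_card_eq hge
      have hdisj : Disjoint S Q := by
        rw [Finset.disjoint_left]
        exact fun i hi hi' => Finset.mem_compl.1 (hQ' (hQ hi')) hi
      have hunion := Finset.card_union_of_disjoint hdisj
      have := hSmax (S ∪ Q) (by
        intro i hi
        rw [hunion]
        rcases Finset.mem_union.1 hi with hi | hi
        · exact ⟨f i, (hf i hi).1, (hf i hi).2.mono (by omega)⟩
        · exact hlow i (hQ hi))
      omega
    have hfd : ∀ i ∈ S, (L i).IsDescending (f i) := fun i hi => (hf i hi).1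
    obtain ⟨σ, hσ⟩ := exists_goodDesc (f := f) hL hfd
    have : Nonempty {Φ : List ℕ × (ℕ × ℕ) → Prop | Sg 1 Φ} :=
      ⟨⟨fun _ => True, .of_primrec (.const True)⟩⟩
    have : Countable {Φ : List ℕ × (ℕ × ℕ) → Prop | Sg 1 Φ} := countable_sg_one
    obtain ⟨G, hG, hGd⟩ := hσ.exists_limit hfd
      (ι := {Φ : List ℕ × (ℕ × ℕ) → Prop | Sg 1 Φ}) (D := fun Φ => Diagonal X Φ.1)
      (fun Φ σ hσ => exists_goodDesc_diagonal hfd (fun i hi => (hf i hi).2) hS hX' Φ.2 hσ)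
    refine ⟨fun i k => G k i, hGd, fun hred => ?_⟩
    obtain ⟨Φ, hΦ, H⟩ := setTuringReducible_iff.1 hred
    exact hG ⟨Φ, hΦ⟩ H

/-! ### Complete sets and least witnesses -/

section JumpHierarchy

/-- The computation with code and input given by `w` halts within `t` steps. -/
def HaltsIn (w t : ℕ) : Prop :=
  (Nat.Partrec.Code.evaln t (Denumerable.ofNat Nat.Partrec.Code w.unpair.1) w.unpair.2).isSome

/-- Appends a witness to the second component of a pair. -/
def addWitness (w y : ℕ) : ℕ := Nat.pair w.unpair.1 (Nat.pair w.unpair.2 y)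

/-- A uniform sequence of complete sets for the levels of the arithmetical hierarchy. -/
def JumpMem : ℕ → ℕ → Prop
  | 0, w => ∃ t, HaltsIn w t
  | j + 1, w => ∃ y, ¬ JumpMem j (addWitness w y)

/-- `y` witnesses that `w` is in the `j`-th set of the hierarchy. -/
def JumpWit : ℕ → ℕ → ℕ → Prop
  | 0, w, y => HaltsIn w y
  | j + 1, w, y => ¬ JumpMem j (addWitness w y)

theorem jumpMem_iff {j w : ℕ} : JumpMem j w ↔ ∃ y, JumpWit j w y := by
  cases j <;> rfl

/-- An index for the matrix also serves for the quantified set, because `addWitness` leaves the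
first component unchanged. -/
theorem IsSigmaZero.exists_jumpMem {j : ℕ} {A : Set ℕ} (h : IsSigmaZero (j + 1) A) :
    ∃ e, ∀ x, x ∈ A ↔ JumpMem j (Nat.pair e x) := by
  induction j generalizing A with
  | zero =>
    obtain ⟨c, hc⟩ := (isSigmaZero_succ_iff_sg.1 h).rePred.exists_code
    refine ⟨Encodable.encode c, fun x => ?_⟩
    rw [hc, Part.dom_iff_mem]
    simp only [JumpMem, HaltsIn, Nat.Partrec.Code.evaln_complete, Option.isSome_iff_exists,
      Nat.unpair_pair, Denumerable.ofNat_encode]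
    exact exists_comm
  | succ j ih =>
    obtain ⟨B, hB, H⟩ := h
    obtain ⟨e, he⟩ := ih hB
    refine ⟨e, fun x => ?_⟩
    simp only [H, he, JumpMem, addWitness, Nat.unpair_pair]

open Classical in
/-- The least witness plus one, at `Nat.pair j w`, if `w` is in the `j`-th set of the hierarchy,
and zero otherwise. -/
noncomputable def leastWit (i : ℕ) : ℕ :=
  if h : ∃ y, JumpWit i.unpair.1 i.unpair.2 y then Nat.find h + 1 else 0

theorem leastWit_eq_zero {i : ℕ} : leastWit i = 0 ↔ ∀ y, ¬ JumpWit i.unpair.1 i.unpair.2 y := by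
  unfold leastWit
  split_ifs with h
  · simpa using h
  · simpa using h

theorem leastWit_eq_succ {i y : ℕ} : leastWit i = y + 1 ↔
    JumpWit i.unpair.1 i.unpair.2 y ∧ ∀ y' < y, ¬ JumpWit i.unpair.1 i.unpair.2 y' := by
  classical
  unfold leastWit
  split_ifs with h
  · rw [Nat.add_right_cancel_iff, Nat.find_eq_iff]
  · exact ⟨fun h' => h'.elim, fun h' => absurd ⟨y, h'.1⟩ h⟩

theorem leastWit_pair_eq_zero {j w : ℕ} : leastWit (Nat.pair j w) = 0 ↔ ¬ JumpMem j w := by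
  rw [leastWit_eq_zero, jumpMem_iff]
  simp

/-- The position which decides whether `y` is a witness for position `i`. -/
def predPos (i y : ℕ) : ℕ := Nat.pair (i.unpair.1 - 1) (addWitness i.unpair.2 y)

/-- Being a witness in a positive column depends on a single entry of the preceding column; this
locality is what the tree checks. -/
theorem jumpWit_iff {i y : ℕ} : JumpWit i.unpair.1 i.unpair.2 y ↔
    (i.unpair.1 = 0 ∧ HaltsIn i.unpair.2 y) ∨ (i.unpair.1 ≠ 0 ∧ leastWit (predPos i y) = 0) := by
  rw [predPos, leastWit_pair_eq_zero]
  cases h : i.unpair.1 <;> simp [JumpWit]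

@[fun_prop] theorem PrimrecPred.haltsIn {α : Type} [Primcodable α] {f g : α → ℕ} (hf : Primrec f)
    (hg : Primrec g) : PrimrecPred fun x => HaltsIn (f x) (g x) := by
  have h1 : Primrec fun x : α => Nat.Partrec.Code.evaln (g x)
      (Denumerable.ofNat Nat.Partrec.Code (f x).unpair.1) (f x).unpair.2 :=
    Nat.Partrec.Code.primrec_evaln.comp
      (f := fun a : (ℕ × Nat.Partrec.Code) × ℕ => Nat.Partrec.Code.evaln a.1.1 a.1.2 a.2)
      (g := fun x => ((g x, Denumerable.ofNat Nat.Partrec.Code (f x).unpair.1), (f x).unpair.2))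
      ((hg.pair ((Primrec.ofNat _).comp (by fun_prop))).pair (by fun_prop))
  unfold HaltsIn
  fun_prop

@[fun_prop] theorem primrec_addWitness {α : Type} [Primcodable α] {f g : α → ℕ} (hf : Primrec f)
    (hg : Primrec g) : Primrec fun x => addWitness (f x) (g x) := by
  unfold addWitness
  fun_prop

@[fun_prop] theorem primrec_predPos {α : Type} [Primcodable α] {f g : α → ℕ} (hf : Primrec f)
    (hg : Primrec g) : Primrec fun x => predPos (f x) (g x) := by
  unfold predPos
  fun_prop

end JumpHierarchy

/-! ### Computable trees with a unique path -/

section WitnessTree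

/-- It is consistent with the string `σ` that `y` is a witness for position `i`. -/
def PosOn (σ : List ℕ) (i y : ℕ) : Prop :=
  (i.unpair.1 = 0 ∧ HaltsIn i.unpair.2 y) ∨ (i.unpair.1 ≠ 0 ∧ σ.getD (predPos i y) 0 = 0)

/-- It is consistent with the string `σ` that `y` is not a witness for position `i`. -/
def NegOn (σ : List ℕ) (i y : ℕ) : Prop :=
  (i.unpair.1 = 0 ∧ ¬ HaltsIn i.unpair.2 y) ∨
    (i.unpair.1 ≠ 0 ∧ (σ.length ≤ predPos i y ∨ σ.getD (predPos i y) 0 ≠ 0))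

/-- The tree of strings which locally look like `leastWit`, with zeros in all columns after `k`. -/
def WitTree (k : ℕ) (σ : List ℕ) : Prop :=
  ∀ i < σ.length, (k < i.unpair.1 ∧ σ.getD i 0 = 0) ∨
    (i.unpair.1 ≤ k ∧ ((σ.getD i 0 = 0 ∧ ∀ y < σ.length, NegOn σ i y) ∨
      (σ.getD i 0 ≠ 0 ∧ PosOn σ i (σ.getD i 0 - 1) ∧ ∀ y < σ.getD i 0 - 1, NegOn σ i y)))

theorem primrecPred_witTree (k : ℕ) : PrimrecPred (WitTree k) := by
  have hneg : ∀ {α : Type} [Primcodable α] {f : α → List ℕ} {g h : α → ℕ}, Primrec f →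
      Primrec g → Primrec h → PrimrecPred fun x => NegOn (f x) (g x) (h x) := by
    intro α _ f g h hf hg hh
    unfold NegOn
    fun_prop
  have hpos : ∀ {α : Type} [Primcodable α] {f : α → List ℕ} {g h : α → ℕ}, Primrec f →
      Primrec g → Primrec h → PrimrecPred fun x => PosOn (f x) (g x) (h x) := by
    intro α _ f g h hf hg hh
    unfold PosOn
    fun_prop
  refine PrimrecPred.ball (p := fun (σ : List ℕ) i => (k < i.unpair.1 ∧ σ.getD i 0 = 0) ∨
    (i.unpair.1 ≤ k ∧ ((σ.getD i 0 = 0 ∧ ∀ y < σ.length, NegOn σ i y) ∨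
      (σ.getD i 0 ≠ 0 ∧ PosOn σ i (σ.getD i 0 - 1) ∧ ∀ y < σ.getD i 0 - 1, NegOn σ i y))))
    (b := fun σ => σ.length) (by fun_prop) ?_
  refine .or (by fun_prop) (.and (by fun_prop) (.or (.and (by fun_prop) ?_)
    (.and (by fun_prop) (.and (hpos (by fun_prop) (by fun_prop) (by fun_prop)) ?_))))
  · exact PrimrecPred.ball (p := fun (z : List ℕ × ℕ) y => NegOn z.1 z.2 y)
      (b := fun z => z.1.length) (by fun_prop) (hneg (by fun_prop) (by fun_prop) (by fun_prop))
  · exact PrimrecPred.ball (p := fun (z : List ℕ × ℕ) y => NegOn z.1 z.2 y)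
      (b := fun z => z.1.getD z.2 0 - 1) (by fun_prop)
      (hneg (by fun_prop) (by fun_prop) (by fun_prop))

/-- The path through the tree `WitTree k`. -/
noncomputable def witPath (k i : ℕ) : ℕ := if i.unpair.1 ≤ k then leastWit i else 0

theorem predPos_unpair {i y : ℕ} : (predPos i y).unpair.1 = i.unpair.1 - 1 := by
  simp [predPos]

theorem witTree_initSeg_witPath (k N : ℕ) : WitTree k (initSeg (witPath k) N) := by
  intro i hi
  rw [length_initSeg] at hi
  simp only [length_initSeg]
  rw [getD_initSeg, if_pos hi, witPath]
  by_cases hk : i.unpair.1 ≤ k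
  · rw [if_pos hk]
    right
    have hpred : ∀ y, witPath k (predPos i y) = leastWit (predPos i y) := fun y => by
      rw [witPath, predPos_unpair, if_pos (by omega)]
    have hneg : ∀ y, ¬ JumpWit i.unpair.1 i.unpair.2 y → NegOn (initSeg (witPath k) N) i y := by
      intro y hy
      rw [jumpWit_iff] at hy
      unfold NegOn
      rw [length_initSeg, getD_initSeg, hpred]
      split_ifs <;> by_cases h0 : i.unpair.1 = 0 <;> simp_all
    have hpos : ∀ y, JumpWit i.unpair.1 i.unpair.2 y → PosOn (initSeg (witPath k) N) i y := by
      intro y hy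
      rw [jumpWit_iff] at hy
      unfold PosOn
      rw [getD_initSeg, hpred]
      split_ifs <;> by_cases h0 : i.unpair.1 = 0 <;> simp_all
    refine ⟨hk, ?_⟩
    cases hl : leastWit i with
    | zero => exact .inl ⟨rfl, fun y _ => hneg y (leastWit_eq_zero.1 hl y)⟩
    | succ y =>
      obtain ⟨h1, h2⟩ := leastWit_eq_succ.1 hl
      exact .inr ⟨by simp, hpos _ h1, fun y' hy' => hneg y' (h2 y' hy')⟩
  · rw [if_neg hk]
    exact .inl ⟨by omega, rfl⟩

/-- Truncation weakens the local conditions: entries beyond the end count as consistent with both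
answers, through the default `0` in `PosOn` and the length clause in `NegOn`. -/
theorem WitTree.take {k : ℕ} {σ : List ℕ} (h : WitTree k σ) {N : ℕ} (hN : N ≤ σ.length) :
    WitTree k (σ.take N) := by
  have hget : ∀ i < N, (σ.take N).getD i 0 = σ.getD i 0 := fun i hi => by
    simp [List.getD, hi]
  have hneg : ∀ i y, NegOn σ i y → NegOn (σ.take N) i y := by
    rintro i y (h | ⟨h0, h⟩)
    · exact .inl h
    · refine .inr ⟨h0, ?_⟩
      rw [List.length_take, min_eq_left hN]
      by_cases hp : N ≤ predPos i y
      · exact .inl hp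
      · rw [hget _ (by omega)]
        exact .inr (h.resolve_left (by omega))
  have hpos : ∀ i y, PosOn σ i y → PosOn (σ.take N) i y := by
    rintro i y (h | ⟨h0, h⟩)
    · exact .inl h
    · refine .inr ⟨h0, ?_⟩
      by_cases hp : N ≤ predPos i y
      · simp [List.getD, hp]
      · rwa [hget _ (by omega)]
  intro i hi
  rw [List.length_take, min_eq_left hN] at hi ⊢
  rw [hget i hi]
  rcases h i (by omega) with h | ⟨hk, ⟨h1, h2⟩ | ⟨h1, h2, h3⟩⟩
  · exact .inl h
  · exact .inr ⟨hk, .inl ⟨h1, fun y hy => hneg _ _ (h2 y (by omega))⟩⟩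
  · exact .inr ⟨hk, .inr ⟨h1, hpos _ _ h2, fun y hy => hneg _ _ (h3 y hy)⟩⟩

/-- Uniqueness of the path, by induction on columns. Once a column is correct, consistency of long
initial segments settles all witness questions of the next one, and recording least witnesses leaves
no choice of value. -/
theorem eq_witPath {k : ℕ} {h : ℕ → ℕ} (hh : ∀ N, WitTree k (initSeg h N)) (i : ℕ) :
    h i = witPath k i := by
  have hget : ∀ {N j}, j < N → (initSeg h N).getD j 0 = h j := fun hj => by
    rw [getD_initSeg, if_pos hj]
  have key : ∀ j ≤ k, ∀ i : ℕ, i.unpair.1 = j → h i = leastWit i := by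
    intro j
    induction j with
    | zero =>
      intro _ i hi
      have hneg : ∀ {N y}, NegOn (initSeg h N) i y → ¬ JumpWit i.unpair.1 i.unpair.2 y := by
        rintro N y (h | h)
        · rw [jumpWit_iff]; tauto
        · exact absurd hi h.1
      have hpos : ∀ {N y}, PosOn (initSeg h N) i y → JumpWit i.unpair.1 i.unpair.2 y := by
        rintro N y (h | h)
        · rw [jumpWit_iff]; tauto
        · exact absurd hi h.1
      cases hv : h i with
      | zero =>
        refine (leastWit_eq_zero.2 fun y => ?_).symm
        have := hh (i + y + 1) i (by rw [length_initSeg]; omega)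
        rw [hget (by omega), hv, length_initSeg] at this
        rcases this with h | ⟨_, ⟨_, h⟩ | ⟨h, _⟩⟩
        · omega
        · exact hneg (h y (by omega))
        · exact absurd rfl h
      | succ y =>
        refine (leastWit_eq_succ.2 ?_).symm
        have := hh (i + 1) i (by rw [length_initSeg]; omega)
        rw [hget (by omega), hv, length_initSeg] at this
        rcases this with ⟨_, h⟩ | ⟨_, ⟨h, _⟩ | ⟨_, h1, h2⟩⟩
        · omega
        · omega
        · exact ⟨hpos h1, fun y' hy' => hneg (h2 y' hy')⟩
    | succ j ih =>
      intro hjk i hi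
      have hp : ∀ y, h (predPos i y) = leastWit (predPos i y) := fun y =>
        ih (by omega) _ (by rw [predPos_unpair]; omega)
      have hneg : ∀ {N y}, predPos i y < N → NegOn (initSeg h N) i y →
          ¬ JumpWit i.unpair.1 i.unpair.2 y := by
        rintro N y hN (h | ⟨h1, h2⟩)
        · omega
        · rw [length_initSeg, hget hN, hp] at h2
          rw [jumpWit_iff]
          have := h2.resolve_left (by omega)
          tauto
      have hpos : ∀ {N y}, predPos i y < N → PosOn (initSeg h N) i y →
          JumpWit i.unpair.1 i.unpair.2 y := by
        rintro N y hN (h | ⟨h1, h2⟩)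
        · omega
        · rw [hget hN, hp] at h2
          rw [jumpWit_iff]
          tauto
      cases hv : h i with
      | zero =>
        refine (leastWit_eq_zero.2 fun y => ?_).symm
        have := hh (i + y + predPos i y + 1) i (by rw [length_initSeg]; omega)
        rw [hget (by omega), hv, length_initSeg] at this
        rcases this with h | ⟨_, ⟨_, h⟩ | ⟨h, _⟩⟩
        · omega
        · exact hneg (by omega) (h y (by omega))
        · exact absurd rfl h
      | succ y =>
        have hN : ∃ N, i < N ∧ ∀ y' ≤ y, predPos i y' < N := by
          refine ⟨i + (Finset.range (y + 1)).sup (predPos i) + 1, by omega, fun y' hy' => ?_⟩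
          have := Finset.le_sup (f := predPos i) (Finset.mem_range.2 (show y' < y + 1 by omega))
          omega
        obtain ⟨N, hiN, hN⟩ := hN
        refine (leastWit_eq_succ.2 ?_).symm
        have := hh N i (by rw [length_initSeg]; omega)
        rw [hget (by omega), hv, length_initSeg] at this
        rcases this with ⟨_, h⟩ | ⟨_, ⟨h, _⟩ | ⟨_, h1, h2⟩⟩
        · omega
        · omega
        · exact ⟨hpos (hN _ (by omega)) h1, fun y' hy' => hneg (hN _ (by omega)) (h2 y' hy')⟩
  unfold witPath
  split_ifs with hk
  · exact key _ hk i rfl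
  · have := hh (i + 1) i (by rw [length_initSeg]; omega)
    rw [hget (by omega)] at this
    rcases this with h | h
    · exact h.2
    · exact absurd h.1 hk

end WitnessTree

/-! ### The Kleene–Brouwer orders -/

section KleeneBrouwer

/-- A string as a function to `WithTop ℕ`, with value `⊤` beyond its length. -/
def topVal (σ : List ℕ) (i : ℕ) : WithTop ℕ := (σ[i]?).elim ⊤ fun a => (a : WithTop ℕ)

theorem topVal_inj {σ τ : List ℕ} {i : ℕ} : topVal σ i = topVal τ i ↔ σ[i]? = τ[i]? := by
  unfold topVal
  cases σ[i]? <;> cases τ[i]? <;> simp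

theorem topVal_lt {σ τ : List ℕ} {i : ℕ} :
    topVal σ i < topVal τ i ↔ i < σ.length ∧ (τ.length ≤ i ∨ σ.getD i 0 < τ.getD i 0) := by
  unfold topVal
  by_cases h1 : i < σ.length <;> by_cases h2 : i < τ.length <;>
    simp [h1, h2, List.getD, not_lt.1]

/-- The Kleene–Brouwer order on strings. -/
def KBLt (σ τ : List ℕ) : Prop := toLex (topVal σ) < toLex (topVal τ)

theorem KBLt_iff {σ τ : List ℕ} : KBLt σ τ ↔ ∃ i < σ.length, (∀ j < i, σ[j]? = τ[j]?) ∧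
    (τ.length ≤ i ∨ σ.getD i 0 < τ.getD i 0) := by
  have : KBLt σ τ ↔ ∃ i, (∀ j < i, topVal σ j = topVal τ j) ∧ topVal σ i < topVal τ i := Iff.rfl
  rw [this]
  simp only [topVal_lt, topVal_inj]
  exact exists_congr fun i => by tauto

theorem primrecPred_KBLt : PrimrecPred fun z : List ℕ × List ℕ => KBLt z.1 z.2 := by
  refine PrimrecPred.of_eq ?_ fun z => KBLt_iff.symm
  refine PrimrecPred.bex (p := fun (z : List ℕ × List ℕ) i => (∀ j < i, z.1[j]? = z.2[j]?) ∧
    (z.2.length ≤ i ∨ z.1.getD i 0 < z.2.getD i 0)) (b := fun z => z.1.length) (by fun_prop)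
    (.and ?_ (by fun_prop))
  exact PrimrecPred.ball (p := fun (w : (List ℕ × List ℕ) × ℕ) j => w.1.1[j]? = w.1.2[j]?)
    (b := fun w => w.2) (by fun_prop) (by fun_prop)

theorem topVal_injective : Function.Injective topVal := fun _ _ h =>
  List.ext_getElem? fun i => topVal_inj.1 (congrFun h i)

/-- The Kleene–Brouwer order on the strings in `WitTree k`. -/
def witOrder (k : ℕ) : ComputableLinearOrder where
  carrier := {a | WitTree k (Denumerable.ofNat (List ℕ) a)}
  lt a b := KBLt (Denumerable.ofNat (List ℕ) a) (Denumerable.ofNat (List ℕ) b)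
  carrier_computable := ((primrecPred_witTree k).comp (Primrec.ofNat _)).computablePred
  lt_computable := by
    have h1 := (primrecPred_witTree k).comp (Primrec.ofNat (List ℕ))
    exact ((h1.comp Primrec.fst).and ((h1.comp Primrec.snd).and (primrecPred_KBLt.comp
      (((Primrec.ofNat _).comp Primrec.fst).pair
        ((Primrec.ofNat _).comp Primrec.snd))))).computablePred
  lt_irrefl _ _ := lt_irrefl (α := Lex (ℕ → WithTop ℕ)) _
  lt_trans _ _ _ _ _ _ := lt_trans (α := Lex (ℕ → WithTop ℕ))
  lt_total a _ b _ hab := by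
    refine lt_or_gt_of_ne (α := Lex (ℕ → WithTop ℕ)) fun h => hab ?_
    have h2 := topVal_injective (toLex.injective h)
    rw [← Denumerable.encode_ofNat (α := List ℕ) a, h2, Denumerable.encode_ofNat]

/-- A proper extension precedes its prefixes, so the initial segments of the path descend. -/
theorem witOrder_illFounded (k : ℕ) : (witOrder k).IllFounded := by
  refine ComputableLinearOrder.IsDescending.illFounded
    (f := fun N => Encodable.encode (initSeg (witPath k) N)) fun N => ⟨?_, ?_⟩
  · show WitTree k _
    rw [Denumerable.ofNat_encode]
    exact witTree_initSeg_witPath k N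
  · show KBLt _ _
    rw [Denumerable.ofNat_encode, Denumerable.ofNat_encode, KBLt_iff]
    refine ⟨N, by simp, fun j hj => ?_, .inl (by simp)⟩
    rw [getElem?_initSeg, getElem?_initSeg, if_pos (by omega), if_pos hj]

/-- A sequence of strings which descends in the Kleene–Brouwer order converges to a path. -/
theorem exists_limit_of_KBLt {s : ℕ → List ℕ} (hs : ∀ a, KBLt (s (a + 1)) (s a)) :
    ∃ h : ℕ → ℕ, ∀ N, ∃ a₀, ∀ a ≥ a₀, (s a).take N = initSeg h N := by
  have hanti : ∀ a b, a < b → KBLt (s b) (s a) := fun a b hab =>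
    strictAnti_nat_of_succ_lt (f := fun a => toLex (topVal (s a))) hs hab
  have key : ∀ N, ∃ l : List ℕ, l.length = N ∧ ∃ a₀, ∀ a ≥ a₀, (s a).take N = l := by
    intro N
    induction N with
    | zero => exact ⟨[], rfl, 0, by simp⟩
    | succ N ih =>
      obtain ⟨l, hl, a₀, h⟩ := ih
      -- Once the first `N` entries are fixed, entry `N` cannot increase, with `⊤` standing for an
      -- absent entry; so it stays at its minimum once this is attained.
      obtain ⟨a₁, ha₁, hmin⟩ := WellFounded.has_min
        (wellFounded_lt (α := WithTop ℕ)) ((fun a => topVal (s a) N) '' Set.Ici a₀)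
        ⟨_, a₀, Set.mem_Ici.2 le_rfl, rfl⟩
      obtain ⟨a₁, ha₁, rfl⟩ := ha₁
      have ha₁ : a₀ ≤ a₁ := ha₁
      have hagree : ∀ a b, a₀ ≤ a → a₀ ≤ b → ∀ j < N, (s a)[j]? = (s b)[j]? := by
        intro a b ha hb j hj
        have := congrArg (fun l => l[j]?) ((h a ha).trans (h b hb).symm)
        simpa only [List.getElem?_take, hj, if_true] using this
      have hconst : ∀ a ≥ a₁, (s a)[N]? = (s a₁)[N]? := by
        intro a ha
        rw [← topVal_inj]
        rcases ha.eq_or_lt with rfl | hlt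
        · rfl
        · have h1 : ¬ topVal (s a) N < topVal (s a₁) N :=
            hmin _ ⟨a, Set.mem_Ici.2 (ha₁.trans ha), rfl⟩
          by_contra hne
          have h2 : topVal (s a₁) N < topVal (s a) N :=
            lt_of_le_of_ne (not_lt.1 h1) fun h => hne h.symm
          have h3 : KBLt (s a₁) (s a) := by
            rw [topVal_lt] at h2
            exact KBLt_iff.2 ⟨N, h2.1, hagree a₁ a ha₁ (ha₁.trans ha), h2.2⟩
          exact lt_asymm (α := Lex (ℕ → WithTop ℕ)) h3 (hanti _ _ hlt)
      -- If the entry were absent, two consecutive strings would both equal `l`.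
      have hlen : N < (s a₁).length := by
        by_contra! hle
        have e1 : s a₁ = l := by rw [← h a₁ ha₁, List.take_of_length_le hle]
        have e2 : s (a₁ + 1) = l := by
          rw [← h (a₁ + 1) (by omega), List.take_of_length_le]
          have := hconst (a₁ + 1) (by omega)
          rw [List.getElem?_eq_none hle] at this
          exact List.getElem?_eq_none_iff.1 this
        have := hs a₁
        rw [e1, e2] at this
        exact lt_irrefl (α := Lex (ℕ → WithTop ℕ)) _ this
      refine ⟨(s a₁).take (N + 1), by simpa using hlen, a₁, fun a ha => ?_⟩
      apply List.ext_getElem?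
      intro j
      simp only [List.getElem?_take]
      split_ifs with hj
      · rcases (show j < N ∨ j = N by omega) with hj | rfl
        · exact hagree a a₁ (ha₁.trans ha) ha₁ j hj
        · exact hconst a ha
      · rfl
  choose l hl a₀ ha₀ using key
  refine ⟨fun i => (l (i + 1)).getD i 0, fun N => ⟨a₀ N, fun a ha => ?_⟩⟩
  apply List.ext_getElem?
  intro j
  rw [getElem?_initSeg]
  split_ifs with hj
  · let b := max a (a₀ (j + 1))
    have h1 : (s a).take N = (s b).take N := by
      rw [ha₀ N a ha, ha₀ N b (le_trans ha (le_max_left _ _))]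
    have h2 := ha₀ (j + 1) b (le_max_right _ _)
    rw [h1, List.getElem?_take, if_pos hj, ← h2]
    have h3 : j < (s b).length := by
      have := congrArg List.length h2
      rw [List.length_take, hl] at this
      omega
    simp [List.getD, h3]
  · rw [List.getElem?_take, if_neg hj]

end KleeneBrouwer

/-! ### Recovering the jumps from descending sequences -/

section Coding

variable {k : ℕ} {f : ℕ → ℕ}

/-- The string coded by the `a`-th term of a sequence. -/
def strAt (f : ℕ → ℕ) (a : ℕ) : List ℕ := Denumerable.ofNat (List ℕ) (f a)

theorem ComputableLinearOrder.IsDescending.eventually_take_eq (hf : (witOrder k).IsDescending f)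
    (N : ℕ) : ∃ a₀, ∀ a ≥ a₀, (strAt f a).take N = initSeg (witPath k) N := by
  obtain ⟨h, hh⟩ := exists_limit_of_KBLt (s := strAt f) fun a => (hf a).2
  have htree : ∀ N, WitTree k (initSeg h N) := by
    intro N
    obtain ⟨a₀, ha₀⟩ := hh N
    have := ha₀ a₀ le_rfl
    rw [← this]
    refine WitTree.take (σ := strAt f a₀) (hf a₀).1 ?_
    have := congrArg List.length this
    rw [List.length_take, length_initSeg] at this
    omega
  obtain ⟨a₀, ha₀⟩ := hh N
  have e : h = witPath k := funext (eq_witPath htree)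
  exact ⟨a₀, fun a ha => e ▸ ha₀ a ha⟩

/-- No term of a descending sequence is to the left of the path. -/
theorem ComputableLinearOrder.IsDescending.witPath_le (hf : (witOrder k).IsDescending f) {a i : ℕ}
    (hi : i < (strAt f a).length) (h : (strAt f a).take i = initSeg (witPath k) i) :
    witPath k i ≤ (strAt f a).getD i 0 := by
  -- A string to the left of the path precedes every string that follows the path through position
  -- `i`, and later terms of the sequence do so.
  by_contra! hlt
  obtain ⟨a₀, ha₀⟩ := hf.eventually_take_eq (i + 1)
  let b := max (a + 1) a₀
  have hb := ha₀ b (le_max_right _ _)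
  have hanti : KBLt (strAt f b) (strAt f a) :=
    strictAnti_nat_of_succ_lt (f := fun a => toLex (topVal (strAt f a))) (fun a => (hf a).2)
      (lt_of_lt_of_le (Nat.lt_succ_self a) (le_max_left _ _))
  have hget : ∀ j ≤ i, (strAt f b)[j]? = some (witPath k j) := fun j hj => by
    have := congrArg (fun l => l[j]?) hb
    simpa only [List.getElem?_take, getElem?_initSeg, show j < i + 1 by omega, if_true] using this
  have hrev : KBLt (strAt f a) (strAt f b) := by
    refine KBLt_iff.2 ⟨i, hi, fun j hj => ?_, .inr ?_⟩
    · rw [hget j hj.le]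
      have := congrArg (fun l => l[j]?) h
      simpa only [List.getElem?_take, getElem?_initSeg, hj, if_true] using this
    · rwa [List.getD_eq_getElem?_getD (l := strAt f b), hget i le_rfl]
  exact lt_asymm (α := Lex (ℕ → WithTop ℕ)) hanti hrev

/-- A term of a descending sequence which is correct about `leastWit` in columns before `k`, and
about its nonzero entries in column `k`, follows the path. -/
theorem ComputableLinearOrder.IsDescending.take_eq_of_pass (hf : (witOrder k).IsDescending f)
    {a m : ℕ} (hm : m ≤ (strAt f a).length)
    (hpass : ∀ i < m, (i.unpair.1 < k → leastWit i = (strAt f a).getD i 0) ∧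
      (i.unpair.1 = k → (strAt f a).getD i 0 ≠ 0 → leastWit i = (strAt f a).getD i 0)) :
    (strAt f a).take m = initSeg (witPath k) m := by
  induction m with
  | zero => simp [initSeg]
  | succ m ih =>
    have h := ih (by omega) fun i hi => hpass i (by omega)
    have hle := hf.witPath_le (show m < _ from hm) h
    have hval : (strAt f a).getD m 0 = witPath k m := by
      obtain ⟨h1, h2⟩ := hpass m (by omega)
      unfold witPath at hle ⊢
      rcases lt_trichotomy m.unpair.1 k with hk | hk | hk
      · rw [if_pos hk.le, h1 hk]
      · rw [if_pos hk.le] at hle ⊢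
        -- A zero entry needs no verification: the path is nowhere above it, so it is zero there
        -- too.
        by_cases h0 : (strAt f a).getD m 0 = 0
        · omega
        · exact (h2 hk h0).symm
      · rw [if_neg (by omega)]
        have htree : WitTree k (strAt f a) := (hf a).1
        rcases htree m hm with h | h
        · exact h.2
        · omega
    rw [initSeg_succ, ← h, ← hval, List.take_add_one, List.getElem?_eq_getElem hm]
    simp [List.getD, List.getElem?_eq_getElem (show m < _ from hm)]

variable {n : ℕ} {F : Fin n → ℕ → ℕ}

theorem ce_leastWit_eq_zero {G : ℕ → ℕ} {P : ℕ → Prop}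
    (h : CE G fun z : ℕ × ℕ => P z.1 ∧ leastWit z.1 = z.2) {α : Type} [Primcodable α] {g : α → ℕ}
    (hg : Primrec g) :
    (CE G fun x => P (g x) ∧ leastWit (g x) = 0) ∧ CE G fun x => P (g x) ∧ leastWit (g x) ≠ 0 := by
  refine ⟨h.comp (f := fun x => (g x, 0)) (by fun_prop), ?_⟩
  refine (CE.ex (P := fun x y => P (g x) ∧ leastWit (g x) = y + 1)
    (h.comp (f := fun z : α × ℕ => (g z.1, z.2 + 1)) (by fun_prop))).of_eq fun x => ?_
  rw [exists_and_left, Nat.exists_eq_add_one, Nat.pos_iff_ne_zero]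

/-- The columns of `leastWit` up to `n` are computable from descending sequences through the first
`n` orders. -/
theorem ce_leastWit (hF : ∀ i : Fin n, (witOrder i).IsDescending (F i)) {k : ℕ} (hk : k ≤ n) :
    CE (seqJoin F) fun z : ℕ × ℕ => z.1.unpair.1 < k ∧ leastWit z.1 = z.2 := by
  induction k with
  | zero => exact (CE.of_primrec (P := fun _ => False) (.const False)).of_eq fun z => by simp
  | succ k ih =>
    have ih := ih (by omega)
    -- Witness questions of column `k` are answered by column `k - 1`, or by running the computation
    -- if `k = 0`.
    have hwit : (CE (seqJoin F) fun z : ℕ × ℕ => z.1.unpair.1 = k ∧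
        JumpWit z.1.unpair.1 z.1.unpair.2 z.2) ∧ CE (seqJoin F) fun z : ℕ × ℕ =>
        z.1.unpair.1 = k ∧ ¬ JumpWit z.1.unpair.1 z.1.unpair.2 z.2 := by
      obtain ⟨h0, h1⟩ := ce_leastWit_eq_zero (P := fun i => i.unpair.1 < k) ih
        (g := fun z : ℕ × ℕ => predPos z.1 z.2) (by fun_prop)
      constructor
      · refine ((CE.of_primrec (P := fun z : ℕ × ℕ => z.1.unpair.1 = k) (by fun_prop)).and
          ((CE.of_primrec (P := fun z : ℕ × ℕ => z.1.unpair.1 = 0 ∧ HaltsIn z.1.unpair.2 z.2)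
          (by fun_prop)).or ((CE.of_primrec (P := fun z : ℕ × ℕ => z.1.unpair.1 ≠ 0)
          (by fun_prop)).and h0))).of_eq fun z => and_congr_right fun hz => ?_
        rw [jumpWit_iff, predPos_unpair]
        refine or_congr_right (and_congr_right fun h => and_iff_right (by omega))
      · refine ((CE.of_primrec (P := fun z : ℕ × ℕ => z.1.unpair.1 = k) (by fun_prop)).and
          ((CE.of_primrec (P := fun z : ℕ × ℕ => z.1.unpair.1 = 0 ∧ ¬ HaltsIn z.1.unpair.2 z.2)
          (by fun_prop)).or ((CE.of_primrec (P := fun z : ℕ × ℕ => z.1.unpair.1 ≠ 0)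
          (by fun_prop)).and h1))).of_eq fun z => and_congr_right fun hz => ?_
        rw [jumpWit_iff, predPos_unpair]
        by_cases h : z.1.unpair.1 = 0
        · simp [h]
        · have : z.1.unpair.1 - 1 < k := by omega
          simp [h, this]
    -- Nonzero values are confirmed by finitely many witness questions. A zero value cannot be
    -- confirmed this way; it needs the descending sequence.
    have hsucc : CE (seqJoin F) fun z : ℕ × ℕ =>
        z.1.unpair.1 = k ∧ z.2 ≠ 0 ∧ leastWit z.1 = z.2 := by
      refine ((hwit.1.comp (f := fun z : ℕ × ℕ => (z.1, z.2 - 1)) (by fun_prop)).and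
        ((CE.of_primrec (P := fun z : ℕ × ℕ => z.2 ≠ 0) (by fun_prop)).and
        (CE.ball (P := fun (z : ℕ × ℕ) y => z.1.unpair.1 = k ∧
          ¬ JumpWit z.1.unpair.1 z.1.unpair.2 y) (b := fun z => z.2 - 1) (by fun_prop)
          (hwit.2.comp (f := fun w : (ℕ × ℕ) × ℕ => (w.1.1, w.2)) (by fun_prop))))).of_eq ?_
      rintro ⟨i, v⟩
      cases v with
      | zero => simp
      | succ v =>
        simp only [leastWit_eq_succ, Nat.add_sub_cancel]
        constructor
        · rintro ⟨⟨h1, h2⟩, h3, h4⟩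
          exact ⟨h1, h3, h2, fun y hy => (h4 y hy).2⟩
        · rintro ⟨h1, h3, h2, h4⟩
          exact ⟨⟨h1, h2⟩, h3, fun y hy => ⟨h1, h4 y hy⟩⟩
    let G : ℕ → ℕ := F ⟨k, by omega⟩
    have hG : (witOrder k).IsDescending G := hF ⟨k, by omega⟩
    have hjoin : ∀ a, seqJoin F (Nat.pair k a) = G a := fun a => by
      simp [seqJoin, G, show k < n by omega]
    -- the check of a single entry of a string
    have hchk : CE (seqJoin F) fun w : List ℕ × ℕ =>
        (w.2.unpair.1 < k → leastWit w.2 = w.1.getD w.2 0) ∧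
        (w.2.unpair.1 = k → w.1.getD w.2 0 ≠ 0 → leastWit w.2 = w.1.getD w.2 0) := by
      refine (((CE.of_primrec (P := fun w : List ℕ × ℕ => k ≤ w.2.unpair.1) (by fun_prop)).or
        (ih.comp (f := fun w : List ℕ × ℕ => (w.2, w.1.getD w.2 0)) (by fun_prop))).and
        ((CE.of_primrec (P := fun w : List ℕ × ℕ => w.2.unpair.1 ≠ k ∨ w.1.getD w.2 0 = 0)
        (by fun_prop)).or (hsucc.comp (f := fun w : List ℕ × ℕ => (w.2, w.1.getD w.2 0))
        (by fun_prop)))).of_eq fun w => ?_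
      rw [← not_lt]
      dsimp only
      tauto
    -- Search the `k`-th sequence for a term that passes the check up to the wanted position.
    -- Passing forces it onto the path that far, and convergence to the path provides such a term.
    have hcol : CE (seqJoin F) fun z : ℕ × ℕ => z.1.unpair.1 = k ∧ leastWit z.1 = z.2 := by
      have h1 : CE (seqJoin F) fun z : ℕ × ℕ => z.1.unpair.1 = k ∧ ∃ a, ∃ u,
          seqJoin F (Nat.pair k a) = u ∧ (z.1 < (Denumerable.ofNat (List ℕ) u).length ∧
          (Denumerable.ofNat (List ℕ) u).getD z.1 0 = z.2) ∧ ∀ i < z.1 + 1,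
          (i.unpair.1 < k → leastWit i = (Denumerable.ofNat (List ℕ) u).getD i 0) ∧
          (i.unpair.1 = k → (Denumerable.ofNat (List ℕ) u).getD i 0 ≠ 0 →
            leastWit i = (Denumerable.ofNat (List ℕ) u).getD i 0) := by
        have hof : Primrec (Denumerable.ofNat (List ℕ)) := Primrec.ofNat _
        refine .and (.of_primrec (by fun_prop)) (CE.ex (P := fun (z : ℕ × ℕ) a => ∃ u,
          seqJoin F (Nat.pair k a) = u ∧ (z.1 < (Denumerable.ofNat (List ℕ) u).length ∧
          (Denumerable.ofNat (List ℕ) u).getD z.1 0 = z.2) ∧ ∀ i < z.1 + 1,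
          (i.unpair.1 < k → leastWit i = (Denumerable.ofNat (List ℕ) u).getD i 0) ∧
          (i.unpair.1 = k → (Denumerable.ofNat (List ℕ) u).getD i 0 ≠ 0 →
            leastWit i = (Denumerable.ofNat (List ℕ) u).getD i 0)) ?_)
        refine CE.ex (P := fun (w : (ℕ × ℕ) × ℕ) u =>
          seqJoin F (Nat.pair k w.2) = u ∧ (w.1.1 < (Denumerable.ofNat (List ℕ) u).length ∧
          (Denumerable.ofNat (List ℕ) u).getD w.1.1 0 = w.1.2) ∧ ∀ i < w.1.1 + 1,
          (i.unpair.1 < k → leastWit i = (Denumerable.ofNat (List ℕ) u).getD i 0) ∧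
          (i.unpair.1 = k → (Denumerable.ofNat (List ℕ) u).getD i 0 ≠ 0 →
            leastWit i = (Denumerable.ofNat (List ℕ) u).getD i 0))
          (.and (CE.apply_eq (by fun_prop) (by fun_prop))
          (.and (.of_primrec (by fun_prop)) ?_))
        exact CE.ball (P := fun (y : ((ℕ × ℕ) × ℕ) × ℕ) i =>
          (i.unpair.1 < k → leastWit i = (Denumerable.ofNat (List ℕ) y.2).getD i 0) ∧
          (i.unpair.1 = k → (Denumerable.ofNat (List ℕ) y.2).getD i 0 ≠ 0 →
            leastWit i = (Denumerable.ofNat (List ℕ) y.2).getD i 0)) (b := fun y => y.1.1.1 + 1)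
          (by fun_prop) (hchk.comp (f := fun y : (((ℕ × ℕ) × ℕ) × ℕ) × ℕ =>
            (Denumerable.ofNat (List ℕ) y.1.2, y.2)) (by fun_prop))
      refine h1.of_eq fun ⟨i, v⟩ => and_congr_right fun hik => ?_
      dsimp only at hik ⊢
      have hpath : ∀ j : ℕ, j.unpair.1 ≤ k → witPath k j = leastWit j := fun j hj => by
        rw [witPath, if_pos hj]
      constructor
      · rintro ⟨a, _, rfl, ⟨hlen, hv⟩, hpass⟩
        rw [hjoin] at hlen hv hpass
        have := hG.take_eq_of_pass (a := a) (m := i + 1) hlen hpass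
        have h2 := congrArg (fun l => l[i]?) this
        simp only [List.getElem?_take, getElem?_initSeg, Nat.lt_succ_self, if_true] at h2
        rw [← hpath i hik.le, ← hv, List.getD_eq_getElem?_getD]
        exact (congrArg (fun o => o.getD 0) h2).symm
      · rintro rfl
        obtain ⟨a, ha⟩ := hG.eventually_take_eq (i + 1)
        have ha := ha a le_rfl
        have hlen := congrArg List.length ha
        rw [List.length_take, length_initSeg] at hlen
        have hget : ∀ j < i + 1, (strAt G a).getD j 0 = witPath k j := by
          intro j hj
          have := congrArg (fun l => l.getD j 0) ha
          simp only [getD_initSeg, hj, if_true] at this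
          rw [← this]
          simp [List.getD, hj]
        refine ⟨a, _, rfl, ?_⟩
        rw [hjoin]
        refine ⟨⟨show i < (strAt G a).length by omega, ?_⟩, fun j hj =>
          ⟨fun hjk => ?_, fun hjk _ => ?_⟩⟩
        · exact (hget i (by omega)).trans (hpath i hik.le)
        · exact ((hget j hj).trans (hpath j hjk.le)).symm
        · exact ((hget j hj).trans (hpath j hjk.le)).symm
    refine (ih.or hcol).of_eq fun z => ?_
    rw [Nat.lt_succ_iff_lt_or_eq]
    tauto

/-- For `n > 0` the last column decides the complete Σ⁰ₙ set, so one unbounded search enumerates a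
Σ⁰ₙ₊₁ set. -/
theorem ce_of_isSigmaZero (hF : ∀ i : Fin n, (witOrder i).IsDescending (F i)) {A : Set ℕ}
    (hA : IsSigmaZero (n + 1) A) : CE (seqJoin F) fun x => x ∈ A := by
  cases n with
  | zero => exact CE.of_sg (isSigmaZero_succ_iff_sg.1 hA)
  | succ m =>
    obtain ⟨B, hB, H⟩ := hA
    obtain ⟨e, he⟩ := hB.exists_jumpMem
    refine (CE.ex (P := fun x y => (Nat.pair m (Nat.pair e (Nat.pair x y))).unpair.1 < m + 1 ∧
      leastWit (Nat.pair m (Nat.pair e (Nat.pair x y))) = 0)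
      ((ce_leastWit_eq_zero (P := fun i => i.unpair.1 < m + 1) (ce_leastWit hF le_rfl)
        (g := fun z : ℕ × ℕ => Nat.pair m (Nat.pair e (Nat.pair z.1 z.2))) (by fun_prop)).1)).of_eq
      fun x => ?_
    rw [H]
    refine exists_congr fun y => ?_
    rw [he, leastWit_pair_eq_zero]
    simp

end Coding

theorem mainTheorem7 (n : ℕ) :
    (∀ L : Fin n → ComputableLinearOrder, (∀ i, (L i).IllFounded) →
      ∀ X : Set ℕ, ¬ IsDeltaZero (n + 1) X →
        ∃ f : Fin n → ℕ → ℕ, (∀ i, (L i).IsDescending (f i)) ∧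
          ¬ SetTuringReducible X (seqJoin f)) ∧
    (∃ L : Fin n → ComputableLinearOrder, (∀ i, (L i).IllFounded) ∧
      ∀ X : Set ℕ, IsDeltaZero (n + 1) X →
        ∀ f : Fin n → ℕ → ℕ, (∀ i, (L i).IsDescending (f i)) →
          SetTuringReducible X (seqJoin f)) :=
  ⟨fun L hL X hX => exists_isDescending_not_setTuringReducible L hL X hX,
    fun i => witOrder i, fun i => witOrder_illFounded i, fun _ hX _ hf =>
      setTuringReducible_of_ce (ce_of_isSigmaZero hf hX.1) (ce_of_isSigmaZero hf hX.2)⟩
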